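/- Let $\mathscr{F}$ be the set of completely multiplicative functions $f:\mathbb{N}\to\mathbb{C}$ (that is, $f(1)=1$ and $f(mn)=f(m)f(n)$ for all $m,n\ge 1$) with $|f(n)|=1$ for all $n\ge 1$, and put $$D_{f,N}(t)=\frac{1}{\sqrt{N}}\sum_{1\le n\le N} f(n)\,n^{it}.$$ Fix $\delta,\gamma\in(0,1)$. There is $N_0=N_0(\delta,\gamma)$ such that for every integer $N\ge N_0$, every real $C$ with $2/\delta\le C\le(\log N)^{\gamma}$, and $T=N^{C}$, one has $$\sup_{|t|\le T}|D_{f,N}(t)|\ \ge\ \exp\left(\sqrt{(1-\delta)\frac{\log T}{\log\log T}}\right)\qquad\text{for all } f\in\mathscr{F}.$$ Consequently, for the same $N$, $C$ and $T$, the same lower bound holds with $f$ replaced by any realization of a Steinhaus random multiplicative function $\mathbb{X}$, i.e. a random function whose realizations all lie in $\mathscr{F}$ and whose values $\mathbb{X}(p)$ at the primes $p$ are independent and uniformly distributed on the unit circle. -/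

import Mathlib

open Filter MeasureTheory ProbabilityTheory

/-- The set of completely multiplicative functions `f : {1, 2, 3, …} → ℂ` with `|f n| = 1` for all
`n ≥ 1`.  Only the values at positive integers matter; the value `f 0` is unconstrained. -/
def UnimodularCompletelyMultiplicative : Set (ℕ → ℂ) :=
  {f | f 1 = 1 ∧ (∀ m n : ℕ, 1 ≤ m → 1 ≤ n → f (m * n) = f m * f n) ∧ ∀ n : ℕ, 1 ≤ n → ‖f n‖ = 1}

/-- The normalised Dirichlet polynomial `D_{f,N}(t) = N^{-1/2} ∑_{1 ≤ n ≤ N} f(n) n^{it}`. -/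
noncomputable def dirichletPoly (f : ℕ → ℂ) (N : ℕ) (t : ℝ) : ℂ :=
  (1 / (Real.sqrt N : ℂ)) * ∑ n ∈ Finset.Icc 1 N, f n * (n : ℂ) ^ (Complex.I * (t : ℂ))

/-- The supremum of `|D_{f,N}(t)|` over real `t` with `|t| ≤ T`. -/
noncomputable def supDirichletPoly (f : ℕ → ℂ) (N : ℕ) (T : ℝ) : ℝ :=
  sSup ((fun t : ℝ => ‖dirichletPoly f N t‖) '' {t : ℝ | |t| ≤ T})

/-- The uniform probability measure on the unit circle of `ℂ`: the law of `e^{2πiθ}` for `θ`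
uniform on `(0, 1]`. -/
noncomputable def uniformUnitCircle : Measure ℂ :=
  (volume.restrict (Set.Ioc (0 : ℝ) 1)).map
    (fun θ : ℝ => Complex.exp (2 * (Real.pi : ℂ) * Complex.I * (θ : ℂ)))

/-- `X` is a Steinhaus random multiplicative function on `(Ω, P)`: every realization is completely
multiplicative with values on the unit circle, and the values at the primes are independent random
variables uniformly distributed on the unit circle. -/
structure IsSteinhaus {Ω : Type*} [MeasurableSpace Ω] (P : Measure Ω) (X : ℕ → Ω → ℂ) : Prop where
  realization : ∀ ω : Ω, (fun n => X n ω) ∈ UnimodularCompletelyMultiplicative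
  measurable_prime : ∀ p : Nat.Primes, Measurable (X (p : ℕ))
  law_prime : ∀ p : Nat.Primes, P.map (X (p : ℕ)) = uniformUnitCircle
  indep_prime : iIndepFun (fun p : Nat.Primes => X (p : ℕ)) P

open scoped ComplexConjugate NNReal

/-! The proof is a resonance argument with two different resonators. Put `X = log T`, let `P` be the
primes in `(X, X^K]` and `G` the primes in `(X^K, N]`. Let `R` be the sum of `r(m) f(m) m^{it}` over
squarefree `m ≤ e^a` composed of primes of `P`, with `r ≥ 0` multiplicative, and let `S` be the sum
of `g^{-1/2} r(m) f(gm) (gm)^{it}` over `g ∈ G` and the same `m`. Average `√N D R conj S` in `t`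
against a centred Gaussian whose standard deviation lies between `Q = T^{1-δ/8}`, which bounds every
frequency that occurs, and `T`. Off-diagonal terms and the range `|t| > T` are then negligible. On
the diagonal `f` cancels because it is completely multiplicative and unimodular, so the bound is
uniform in `f`.

For `A ∣ B` the solutions `(gA)·(B/A) = g·B` with `gA ≤ N` contribute. Summing `g^{-1/2}` over `g ≤
N/A` gives `√(N/A)` up to a power of `log N`. This is what `G` is for: it lets `n = gA` come close
to `N`, so that the normalisation `N^{-1/2}` is not lost. The diagonal mass relative to `∏(1 +
r(p)²)` is then `∏(1 + r(p) p^{-1/2}/(1 + r(p)²))`, up to a power of `log N`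
(`le_diagonalSum_resonators`, `supDirichletPoly_lower_bound`).

The choice `r(p) = L/(√p log p)` (`exists_resonator`) makes this product at least
`exp((√(1-δ)+θ)√(X/log X))` for some `θ > 0`, and the factor `exp(θ√(X/log X))` absorbs all powers
of `log N`. A Markov inequality shows that the truncations `B ≤ e^a` and `A ≤ N^{1/4}` keep a fixed
proportion of the mass. The condition `C ≥ 2/δ` leaves room for `a`, and `C ≤ (log N)^γ` with `γ <
1` makes typical `A` smaller than `N^{1/4}`. -/

/-! ### Mertens' estimate for `∑ log p / p`, from the factorisation of `n!`. -/

theorem log_factorial_eq_sum_primes (n : ℕ) :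
    Real.log (n.factorial) =
      ∑ p ∈ (Finset.Icc 1 n).filter Nat.Prime, (padicValNat p n.factorial : ℝ) * Real.log p := by
  have h := Nat.prod_factorization_pow_eq_self (Nat.factorial_ne_zero n)
  have h2 : (n.factorial : ℝ) = ∏ p ∈ (Finset.Icc 1 n).filter Nat.Prime,
      (p : ℝ) ^ (padicValNat p n.factorial) := by
    conv_lhs => rw [← h]
    rw [Finsupp.prod, Nat.cast_prod]
    refine Finset.prod_subset_one_on_sdiff ?_ ?_ ?_
    · intro p hp
      have hp' := Nat.prime_of_mem_primeFactors hp
      have := (hp'.dvd_factorial).1 (Nat.dvd_of_mem_primeFactors hp)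
      simp [hp', this, hp'.one_le]
    · intro p hp
      rw [Finset.mem_sdiff, Finset.mem_filter] at hp
      have := hp.2
      rw [Finsupp.mem_support_iff, not_not, Nat.factorization_def _ hp.1.2] at this
      simp [this]
    · intro p hp
      have hp' := Nat.prime_of_mem_primeFactors hp
      rw [Nat.factorization_def _ hp', Nat.cast_pow]
  rw [h2, Real.log_prod]
  · simp [Real.log_pow]
  · intro p hp
    have := (Finset.mem_filter.1 hp).2.pos
    positivity

theorem padicValNat_factorial_le_div {p : ℕ} (hp : p.Prime) (n : ℕ) :
    (padicValNat p n.factorial : ℝ) ≤ n / (p - 1) := by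
  have := Fact.mk hp
  have h := sub_one_mul_padicValNat_factorial (p := p) n
  have h1 : (p - 1) * padicValNat p n.factorial ≤ n := h ▸ Nat.sub_le _ _
  have hp1 : (0 : ℝ) < p - 1 := by
    have : (1 : ℝ) < p := by exact_mod_cast hp.one_lt
    linarith
  rw [le_div_iff₀ hp1, mul_comm]
  have h2 : (((p - 1 : ℕ) : ℝ)) * (padicValNat p n.factorial : ℝ) ≤ n := by exact_mod_cast h1
  rwa [Nat.cast_sub hp.one_le, Nat.cast_one] at h2

theorem le_padicValNat_factorial {p : ℕ} (hp : p.Prime) (n : ℕ) :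
    (n : ℝ) / p - 1 ≤ padicValNat p n.factorial := by
  have := Fact.mk hp
  have h : p ^ (n / p) ∣ n.factorial := by
    have h1 : p ^ (n / p) ∣ (p * (n / p)).factorial := by
      have := padicValNat_factorial_mul (p := p) (n / p)
      rw [padicValNat_dvd_iff_le (Nat.factorial_ne_zero _), this]
      omega
    exact h1.trans (Nat.factorial_dvd_factorial (Nat.mul_div_le n p))
  rw [padicValNat_dvd_iff_le (Nat.factorial_ne_zero _)] at h
  have h3 : (n : ℝ) / p < (n / p : ℕ) + 1 := by
    rw [div_lt_iff₀ (by exact_mod_cast hp.pos)]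
    have := Nat.lt_div_mul_add (a := n) hp.pos
    have h4 : n < (n / p + 1) * p := by linarith [this]
    exact_mod_cast h4
  have h4 : ((n / p : ℕ) : ℝ) ≤ padicValNat p n.factorial := by exact_mod_cast h
  linarith

theorem sum_log_div_prime_le {n : ℕ} (hn : 1 ≤ n) :
    ∑ p ∈ (Finset.Icc 1 n).filter Nat.Prime, Real.log p / p ≤ Real.log n + Real.log 4 := by
  have hn' : (0 : ℝ) < n := by exact_mod_cast hn
  have h1 : ∑ p ∈ (Finset.Icc 1 n).filter Nat.Prime, ((n : ℝ) / p - 1) * Real.log p ≤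
      Real.log n.factorial := by
    rw [log_factorial_eq_sum_primes]
    refine Finset.sum_le_sum fun p hp => ?_
    have hp' := (Finset.mem_filter.1 hp).2
    exact mul_le_mul_of_nonneg_right (le_padicValNat_factorial hp' n) (Real.log_natCast_nonneg p)
  have h2 : Real.log n.factorial ≤ n * Real.log n := by
    rw [← Real.log_pow]
    exact Real.log_le_log (by exact_mod_cast Nat.factorial_pos n)
      (by exact_mod_cast Nat.factorial_le_pow n)
  have h3 : ∑ p ∈ (Finset.Icc 1 n).filter Nat.Prime, Real.log p ≤ Real.log 4 * n := by
    have := Chebyshev.theta_le_log4_mul_x (x := n) hn'.le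
    refine le_trans (le_of_eq ?_) this
    rw [Chebyshev.theta, Nat.floor_natCast]
    rfl
  have h4 : ∑ p ∈ (Finset.Icc 1 n).filter Nat.Prime, ((n : ℝ) / p - 1) * Real.log p =
      n * (∑ p ∈ (Finset.Icc 1 n).filter Nat.Prime, Real.log p / p) -
        ∑ p ∈ (Finset.Icc 1 n).filter Nat.Prime, Real.log p := by
    rw [Finset.mul_sum, ← Finset.sum_sub_distrib]
    exact Finset.sum_congr rfl fun p _ => by ring
  have h5 : (n : ℝ) * (∑ p ∈ (Finset.Icc 1 n).filter Nat.Prime, Real.log p / p) ≤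
      n * (Real.log n + Real.log 4) := by linarith
  exact le_of_mul_le_mul_left h5 hn'

/-- Compare `log n! ≥ n log n - n` with the bound `n/(p-1)` for the exponent of `p`. Replacing `p -
1` by `p` costs `log p/(p(p-1)) ≤ 4 p^{-3/2}`, which is summable. -/
theorem exists_le_sum_log_div_prime :
    ∃ E : ℝ, ∀ n : ℕ, 1 ≤ n →
      Real.log n - E ≤ ∑ p ∈ (Finset.Icc 1 n).filter Nat.Prime, Real.log p / p := by
  have hs : Summable fun n : ℕ => 1 / (n : ℝ) ^ (3 / 2 : ℝ) :=
    Real.summable_one_div_nat_rpow.2 (by norm_num)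
  refine ⟨1 + 4 * ∑' n : ℕ, 1 / (n : ℝ) ^ (3 / 2 : ℝ), fun n hn => ?_⟩
  have hn' : (0 : ℝ) < n := by exact_mod_cast hn
  have h1 : Real.log n.factorial ≤
      ∑ p ∈ (Finset.Icc 1 n).filter Nat.Prime, n * (Real.log p / p + 4 * (1 / (p : ℝ) ^ (3 / 2 : ℝ))) := by
    rw [log_factorial_eq_sum_primes]
    refine Finset.sum_le_sum fun p hp => ?_
    have hp' := (Finset.mem_filter.1 hp).2
    have hp2 : (2 : ℝ) ≤ p := by exact_mod_cast hp'.two_le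
    refine (mul_le_mul_of_nonneg_right (padicValNat_factorial_le_div hp' n)
      (Real.log_natCast_nonneg p)).trans ?_
    rw [div_mul_eq_mul_div, mul_div_assoc]
    refine mul_le_mul_of_nonneg_left ?_ hn'.le
    have hlog : Real.log p ≤ 2 * (p : ℝ) ^ (1 / 2 : ℝ) := by
      have := Real.log_le_rpow_div (x := p) (ε := 1 / 2) (by positivity) (by norm_num)
      linarith
    have e1 : Real.log p / (p - 1) = Real.log p / p + Real.log p / (p * (p - 1)) := by
      have : (p : ℝ) - 1 ≠ 0 := by linarith
      field_simp
      ring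
    have e2 : (p : ℝ) ^ (3 / 2 : ℝ) = p * (p : ℝ) ^ (1 / 2 : ℝ) := by
      rw [show (3 / 2 : ℝ) = 1 + 1 / 2 by norm_num, Real.rpow_add (by positivity), Real.rpow_one]
    have e3 : (p : ℝ) ^ (1 / 2 : ℝ) * (p : ℝ) ^ (1 / 2 : ℝ) = p := by
      rw [← Real.rpow_add (by positivity)]; norm_num
    rw [e1]
    gcongr
    have hq : 0 < (p : ℝ) ^ (1 / 2 : ℝ) := by positivity
    rw [e2, mul_one_div, div_le_div_iff₀ (by nlinarith) (by positivity)]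
    set q := (p : ℝ) ^ (1 / 2 : ℝ)
    calc Real.log p * (p * q) ≤ (2 * q) * (p * q) := by gcongr
      _ = 2 * p * p := by rw [← e3]; ring
      _ ≤ 4 * (p * (p - 1)) := by nlinarith
  rw [← Finset.mul_sum, Finset.sum_add_distrib, ← Finset.mul_sum] at h1
  have h2 : ∑ p ∈ (Finset.Icc 1 n).filter Nat.Prime, 1 / (p : ℝ) ^ (3 / 2 : ℝ) ≤
      ∑' n : ℕ, 1 / (n : ℝ) ^ (3 / 2 : ℝ) :=
    hs.sum_le_tsum _ fun i _ => by positivity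
  have h3 : (n : ℝ) * (Real.log n - 1) ≤ Real.log n.factorial := by
    have h := Real.pow_div_factorial_le_exp (n : ℝ) hn'.le n
    have hf : (0 : ℝ) < n.factorial := by exact_mod_cast Nat.factorial_pos n
    have h' := Real.log_le_log (by positivity) h
    rw [Real.log_div (by positivity) hf.ne', Real.log_pow, Real.log_exp] at h'
    linarith
  have h4 := h3.trans h1
  have := le_of_mul_le_mul_left h4 hn'
  linarith

/-! ### Sums over primes in intervals. -/

/-- The primes in the interval `(x, y]`. -/
noncomputable def primesBetween (x y : ℝ) : Finset ℕ :=
  (Finset.Ioc ⌊x⌋₊ ⌊y⌋₊).filter Nat.Prime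

theorem mem_primesBetween {x y : ℝ} (hx : 0 ≤ x) (hy : 0 ≤ y) {p : ℕ} :
    p ∈ primesBetween x y ↔ (x < p ∧ p ≤ y) ∧ p.Prime := by
  rw [primesBetween, Finset.mem_filter, Finset.mem_Ioc, Nat.floor_lt hx, Nat.le_floor_iff hy]

theorem sum_primesBetween_add {x y z : ℝ} (hxy : x ≤ y) (hyz : y ≤ z) (F : ℕ → ℝ) :
    ∑ p ∈ primesBetween x y, F p + ∑ p ∈ primesBetween y z, F p =
      ∑ p ∈ primesBetween x z, F p := by
  unfold primesBetween
  rw [← Finset.sum_union]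
  · congr 1
    rw [← Finset.filter_union, Finset.Ioc_union_Ioc_eq_Ioc (Nat.floor_mono hxy) (Nat.floor_mono hyz)]
  · refine Finset.disjoint_filter_filter (Finset.disjoint_left.2 fun a ha hb => ?_)
    rw [Finset.mem_Ioc] at ha hb
    omega

theorem exists_abs_sum_primesBetween_sub_le :
    ∃ E : ℝ, 0 < E ∧ ∀ x y : ℝ, 1 ≤ x → x ≤ y →
      |∑ p ∈ primesBetween x y, Real.log p / p - (Real.log y - Real.log x)| ≤ E := by
  obtain ⟨E, hE⟩ := exists_le_sum_log_div_prime
  refine ⟨|E| + Real.log 4 + Real.log 2, by positivity, fun x y hx hxy => ?_⟩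
  have key : ∀ z : ℝ, 1 ≤ z → 1 ≤ ⌊z⌋₊ ∧ Real.log z - Real.log 2 ≤ Real.log ⌊z⌋₊ ∧
      Real.log ⌊z⌋₊ ≤ Real.log z := by
    intro z hz
    have h1 : 1 ≤ ⌊z⌋₊ := Nat.one_le_floor_iff _ |>.2 hz
    have h1' : (1 : ℝ) ≤ ⌊z⌋₊ := by exact_mod_cast h1
    refine ⟨h1, ?_, Real.log_le_log (by positivity) (Nat.floor_le (by positivity))⟩
    rw [← Real.log_div (by positivity) (by norm_num)]
    refine Real.log_le_log (by positivity) ?_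
    have := Nat.lt_floor_add_one z
    linarith
  obtain ⟨x1, x2, x3⟩ := key x hx
  obtain ⟨y1, y2, y3⟩ := key y (hx.trans hxy)
  have hsum : ∑ p ∈ (Finset.Icc 1 ⌊x⌋₊).filter Nat.Prime, Real.log p / p +
      ∑ p ∈ primesBetween x y, Real.log p / p =
      ∑ p ∈ (Finset.Icc 1 ⌊y⌋₊).filter Nat.Prime, Real.log p / p := by
    unfold primesBetween
    rw [← Finset.sum_union]
    · congr 1
      rw [← Finset.filter_union]
      congr 1
      ext a
      have := Nat.floor_mono hxy
      simp only [Finset.mem_union, Finset.mem_Icc, Finset.mem_Ioc]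
      omega
    · refine Finset.disjoint_filter_filter (Finset.disjoint_left.2 fun a ha hb => ?_)
      rw [Finset.mem_Icc] at ha
      rw [Finset.mem_Ioc] at hb
      omega
  have a1 := hE _ x1
  have a2 := hE _ y1
  have b1 := sum_log_div_prime_le x1
  have b2 := sum_log_div_prime_le y1
  have := le_abs_self E
  rw [abs_le]
  constructor <;> linarith

/-- A lower Riemann sum for `∫ du/u²` with `u = log p / log X`. Each block `(X^{w-h}, X^w]` has `log
p / p` mass at least `h log X - E`, and there `log p ≤ w log X`. The bound `h/w² ≥ 1/w - 1/(w+h)`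
telescopes. -/
theorem le_sum_inv_mul_log_primesBetween {E h X : ℝ} (hh : 0 < h) (hX : 1 < X)
    (hE : ∀ x y : ℝ, 1 ≤ x → x ≤ y →
      |∑ p ∈ primesBetween x y, Real.log p / p - (Real.log y - Real.log x)| ≤ E)
    (hlarge : E ≤ h * Real.log X) (n : ℕ) :
    (1 - E / (h * Real.log X)) * (1 / (1 + h) - 1 / (1 + (n + 1) * h)) / Real.log X ≤
      ∑ p ∈ primesBetween X (X ^ (1 + n * h)), 1 / (p * Real.log p) := by
  have hl : 0 < Real.log X := Real.log_pos hX
  induction n with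
  | zero => simpa using Finset.sum_nonneg fun p _ => by positivity
  | succ n ih =>
    have hX0 : 0 < X := by linarith
    have hA : X ≤ X ^ (1 + n * h) := by
      conv_lhs => rw [← Real.rpow_one X]
      exact Real.rpow_le_rpow_of_exponent_le hX.le (by have : 0 ≤ n * h := by positivity
                                                       linarith)
    have hB : X ^ (1 + n * h) ≤ X ^ (1 + (n + 1 : ℕ) * h) :=
      Real.rpow_le_rpow_of_exponent_le hX.le (by push_cast; linarith)
    rw [← sum_primesBetween_add hA hB]
    have hm := (abs_le.1 (hE _ _ (hX.le.trans hA) hB)).1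
    rw [Real.log_rpow hX0, Real.log_rpow hX0] at hm
    set w := 1 + (n + 1 : ℕ) * h with hw
    have hw0 : 0 < w := by positivity
    have hstep : (h * Real.log X - E) / (w * Real.log X) ^ 2 ≤
        ∑ p ∈ primesBetween (X ^ (1 + n * h)) (X ^ w), 1 / (p * Real.log p) := by
      calc (h * Real.log X - E) / (w * Real.log X) ^ 2
          ≤ (∑ p ∈ primesBetween (X ^ (1 + n * h)) (X ^ w), Real.log p / p) /
            (w * Real.log X) ^ 2 := by
            gcongr
            have : w * Real.log X - (1 + n * h) * Real.log X = h * Real.log X := by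
              rw [hw]; push_cast; ring
            linarith
        _ ≤ _ := by
            rw [Finset.sum_div]
            refine Finset.sum_le_sum fun p hp => ?_
            rw [mem_primesBetween (by positivity) (by positivity)] at hp
            have hp1 : (1 : ℝ) < p := by exact_mod_cast hp.2.one_lt
            have hlp : 0 < Real.log p := Real.log_pos hp1
            have hle : Real.log p ≤ w * Real.log X := by
              rw [← Real.log_rpow hX0]
              exact Real.log_le_log (by linarith) hp.1.2
            rw [div_div, div_le_div_iff₀ (by positivity) (by positivity)]
            have : Real.log p ^ 2 ≤ (w * Real.log X) ^ 2 := by gcongr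
            nlinarith
    have hc : 0 ≤ 1 - E / (h * Real.log X) := by
      rw [sub_nonneg, div_le_one (by positivity)]; exact hlarge
    have htel : (1 - E / (h * Real.log X)) * (1 / w - 1 / (w + h)) / Real.log X ≤
        (h * Real.log X - E) / (w * Real.log X) ^ 2 := by
      have e1 : (h * Real.log X - E) / (w * Real.log X) ^ 2 =
          (1 - E / (h * Real.log X)) * (h / w ^ 2) / Real.log X := by
        field_simp
      rw [e1]
      gcongr
      rw [div_sub_div _ _ hw0.ne' (by positivity), div_le_div_iff₀ (by positivity) (by positivity)]
      nlinarith [mul_pos hh hw0, mul_pos (mul_pos hh hh) (mul_pos hw0 hw0), mul_pos (mul_pos hh hh) hw0]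
    have e2 : 1 + ((n + 1 : ℕ) + 1 : ℝ) * h = w + h := by rw [hw]; ring
    have e3 : 1 + ((n : ℝ) + 1) * h = w := by rw [hw]; push_cast; ring
    rw [e3] at ih
    rw [e2]
    have : (1 - E / (h * Real.log X)) * (1 / (1 + h) - 1 / (w + h)) / Real.log X =
      (1 - E / (h * Real.log X)) * (1 / (1 + h) - 1 / w) / Real.log X +
      (1 - E / (h * Real.log X)) * (1 / w - 1 / (w + h)) / Real.log X := by ring
    linarith

theorem exists_le_sum_inv_mul_log_primesBetween {ε : ℝ} (hε : 0 < ε) :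
    ∃ K : ℝ, 1 ≤ K ∧ ∀ᶠ X : ℝ in atTop,
      (1 - ε) / Real.log X ≤ ∑ p ∈ primesBetween X (X ^ K), 1 / (p * Real.log p) ∧
      ∑ p ∈ primesBetween X (X ^ K), 1 / (p : ℝ) ≤ K := by
  obtain ⟨E, hE0, hE⟩ := exists_abs_sum_primesBetween_sub_le
  obtain ⟨h, hh, hh1⟩ : ∃ h : ℝ, 0 < h ∧ 1 - ε / 3 ≤ 1 / (1 + h) := by
    refine ⟨ε / 3, by positivity, ?_⟩
    rw [le_div_iff₀ (by positivity)]
    nlinarith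
  obtain ⟨n, hn⟩ : ∃ n : ℕ, 1 / (1 + ((n : ℝ) + 1) * h) ≤ ε / 3 := by
    obtain ⟨n, hn⟩ := exists_nat_gt (3 / ε / h)
    refine ⟨n, ?_⟩
    rw [div_lt_iff₀ hh, div_lt_iff₀ hε] at hn
    rw [div_le_div_iff₀ (by positivity) (by norm_num)]
    nlinarith [mul_pos hh hε]
  refine ⟨1 + n * h, by have : 0 ≤ n * h := by positivity
                        linarith, ?_⟩
  have t := Real.tendsto_log_atTop
  filter_upwards [eventually_gt_atTop 1, t.eventually_ge_atTop (E / h),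
    t.eventually_ge_atTop (E / (h * (ε / 3))), t.eventually_ge_atTop E] with X hX h1 h2 h3
  have hl : 0 < Real.log X := Real.log_pos hX
  have hX0 : 0 < X := by linarith
  rw [div_le_iff₀ hh] at h1
  rw [div_le_iff₀ (by positivity)] at h2
  have hA : X ≤ X ^ (1 + n * h) := by
    conv_lhs => rw [← Real.rpow_one X]
    exact Real.rpow_le_rpow_of_exponent_le hX.le (by have : 0 ≤ n * h := by positivity
                                                     linarith)
  constructor
  · refine le_trans ?_ (le_sum_inv_mul_log_primesBetween hh hX hE (by linarith) n)
    gcongr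
    have a1 : E / (h * Real.log X) ≤ ε / 3 := by
      rw [div_le_iff₀ (by positivity)]; linarith
    have a2 : 0 ≤ E / (h * Real.log X) := by positivity
    have a3 : 1 / (1 + h) ≤ 1 := by rw [div_le_one (by positivity)]; linarith
    have a4 : 0 < 1 / (1 + ((n : ℝ) + 1) * h) := by positivity
    nlinarith
  · have hm := (abs_le.1 (hE _ _ hX.le hA)).2
    rw [Real.log_rpow hX0] at hm
    have : (∑ p ∈ primesBetween X (X ^ (1 + n * h)), 1 / (p : ℝ)) * Real.log X ≤
        ∑ p ∈ primesBetween X (X ^ (1 + n * h)), Real.log p / p := by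
      rw [Finset.sum_mul]
      refine Finset.sum_le_sum fun p hp => ?_
      rw [mem_primesBetween (by positivity) (by positivity)] at hp
      rw [one_div_mul_eq_div]
      gcongr
      exact hp.1.1.le
    refine le_of_mul_le_mul_right ?_ hl
    linarith

/-! ### Gaussian mean values of Dirichlet polynomials. -/

/-- The generalised Dirichlet polynomial `∑ α i · f (ν i) · (ν i)^{it}` over a finite index set. -/
noncomputable def twistedSum {ι : Type*} (f : ℕ → ℂ) (s : Finset ι) (α : ι → ℝ) (ν : ι → ℕ)
    (t : ℝ) : ℂ :=
  ∑ i ∈ s, (α i : ℂ) * (f (ν i) * (ν i : ℂ) ^ (Complex.I * (t : ℂ)))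

/-- The sum of `α i * β j` over the pairs `(i, j)` with `ν i = μ j`. -/
noncomputable def diagonalSum {ι κ : Type*} (s : Finset ι) (α : ι → ℝ) (ν : ι → ℕ)
    (u : Finset κ) (β : κ → ℝ) (μ : κ → ℕ) : ℝ :=
  ∑ i ∈ s, ∑ j ∈ u, if ν i = μ j then α i * β j else 0

theorem natCast_cpow_I_mul {n : ℕ} (hn : 1 ≤ n) (t : ℝ) :
    (n : ℂ) ^ (Complex.I * (t : ℂ)) = Complex.exp (((t * Real.log n : ℝ) : ℂ) * Complex.I) := by
  rw [Complex.cpow_def_of_ne_zero (by exact_mod_cast (by omega : n ≠ 0))]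
  congr 1
  rw [Complex.natCast_log.symm]
  push_cast
  ring

theorem norm_natCast_cpow_I_mul {n : ℕ} (hn : 1 ≤ n) (t : ℝ) :
    ‖(n : ℂ) ^ (Complex.I * (t : ℂ))‖ = 1 := by
  rw [natCast_cpow_I_mul hn, Complex.norm_exp_ofReal_mul_I]

theorem one_div_le_abs_log_sub_log {u v : ℕ} {Q : ℝ} (hu : 1 ≤ u) (hv : 1 ≤ v)
    (huQ : u ≤ Q) (hvQ : v ≤ Q) (huv : u ≠ v) :
    1 / Q ≤ |Real.log u - Real.log v| := by
  have key : ∀ a b : ℕ, 1 ≤ a → (b : ℝ) ≤ Q → a < b → 1 / Q ≤ Real.log b - Real.log a := by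
    intro a b ha hbQ hab
    have ha' : (1 : ℝ) ≤ a := by exact_mod_cast ha
    have hab' : (a : ℝ) + 1 ≤ b := by exact_mod_cast hab
    have h := Real.one_sub_inv_le_log_of_pos (x := (b : ℝ) / a) (div_pos (by linarith) (by linarith))
    rw [Real.log_div (by linarith) (by linarith), inv_div] at h
    refine le_trans ?_ h
    rw [one_sub_div (by linarith), div_le_div_iff₀ (by linarith) (by linarith)]
    nlinarith
  rcases lt_or_gt_of_ne huv with h | h
  · rw [abs_sub_comm]
    exact (key u v hu hvQ h).trans (le_abs_self _)
  · exact (key v u hv huQ h).trans (le_abs_self _)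

section Mean

variable {ι κ : Type*} {f : ℕ → ℂ}

theorem UnimodularCompletelyMultiplicative.conj_mul_self
    (hf : f ∈ UnimodularCompletelyMultiplicative) {n : ℕ} (hn : 1 ≤ n) :
    f n * conj (f n) = 1 := by
  rw [Complex.mul_conj, Complex.normSq_eq_norm_sq, hf.2.2 n hn]
  simp

theorem norm_twistedSum_le (hf : f ∈ UnimodularCompletelyMultiplicative) (s : Finset ι)
    {α : ι → ℝ} {ν : ι → ℕ} (hα : ∀ i ∈ s, 0 ≤ α i) (hν : ∀ i ∈ s, 1 ≤ ν i) (t : ℝ) :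
    ‖twistedSum f s α ν t‖ ≤ ∑ i ∈ s, α i := by
  refine (norm_sum_le _ _).trans (Finset.sum_le_sum fun i hi => ?_)
  rw [norm_mul, norm_mul, hf.2.2 _ (hν i hi), norm_natCast_cpow_I_mul (hν i hi), Complex.norm_real,
    Real.norm_of_nonneg (hα i hi)]
  simp

theorem continuous_twistedSum (s : Finset ι) {α : ι → ℝ} {ν : ι → ℕ} (hν : ∀ i ∈ s, 1 ≤ ν i) :
    Continuous (twistedSum f s α ν) := by
  refine continuous_finsetSum _ fun i hi => ?_
  simp_rw [natCast_cpow_I_mul (hν i hi)]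
  fun_prop

theorem integral_gaussianReal_cpow_mul_conj (v : ℝ≥0) {m n : ℕ} (hm : 1 ≤ m) (hn : 1 ≤ n) :
    ∫ t : ℝ, (m : ℂ) ^ (Complex.I * (t : ℂ)) * conj ((n : ℂ) ^ (Complex.I * (t : ℂ)))
      ∂(gaussianReal 0 v) = (Real.exp (-(v * (Real.log m - Real.log n) ^ 2 / 2)) : ℝ) := by
  have h := charFun_gaussianReal (μ := 0) (v := v) (Real.log m - Real.log n)
  rw [charFun_apply_real] at h
  have e : ∀ t : ℝ, (m : ℂ) ^ (Complex.I * (t : ℂ)) * conj ((n : ℂ) ^ (Complex.I * (t : ℂ))) =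
      Complex.exp (((Real.log m - Real.log n : ℝ) : ℂ) * (t : ℂ) * Complex.I) := by
    intro t
    rw [natCast_cpow_I_mul hm, natCast_cpow_I_mul hn, ← Complex.exp_conj, ← Complex.exp_add]
    congr 1
    simp only [map_mul, Complex.conj_ofReal, Complex.conj_I]
    push_cast
    ring
  simp_rw [e]
  rw [h]
  push_cast
  congr 1
  ring

theorem integrable_cpow_mul_conj (v : ℝ≥0) {m n : ℕ} (hm : 1 ≤ m) (hn : 1 ≤ n) :
    Integrable (fun t : ℝ => (m : ℂ) ^ (Complex.I * (t : ℂ)) *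
      conj ((n : ℂ) ^ (Complex.I * (t : ℂ)))) (gaussianReal 0 v) := by
  refine Integrable.of_bound (C := 1) (Continuous.aestronglyMeasurable ?_) ?_
  · simp_rw [natCast_cpow_I_mul hm, natCast_cpow_I_mul hn]
    fun_prop
  · refine Eventually.of_forall fun t => ?_
    rw [norm_mul, RCLike.norm_conj, norm_natCast_cpow_I_mul hm, norm_natCast_cpow_I_mul hn]
    simp

/-- The Gaussian characteristic function damps a pair of frequencies `m ≠ n` by `exp(-v (log m - log
n)²/2)`, and distinct integers up to `Q` have logarithms at least `1/Q` apart. On the diagonal `f(n)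
conj f(n) = 1`. -/
theorem norm_integral_twistedSum_mul_conj_sub_le (hf : f ∈ UnimodularCompletelyMultiplicative)
    (s : Finset ι) (u : Finset κ) {α : ι → ℝ} {ν : ι → ℕ} {β : κ → ℝ} {μ : κ → ℕ} {Q : ℝ}
    (hα : ∀ i ∈ s, 0 ≤ α i) (hβ : ∀ j ∈ u, 0 ≤ β j) (hν : ∀ i ∈ s, 1 ≤ ν i ∧ (ν i : ℝ) ≤ Q)
    (hμ : ∀ j ∈ u, 1 ≤ μ j ∧ (μ j : ℝ) ≤ Q) (v : ℝ≥0) :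
    ‖∫ t, twistedSum f s α ν t * conj (twistedSum f u β μ t) ∂(gaussianReal 0 v) -
        (diagonalSum s α ν u β μ : ℂ)‖ ≤
      (∑ i ∈ s, α i) * (∑ j ∈ u, β j) * Real.exp (-(v / (2 * Q ^ 2))) := by
  have e : ∀ t : ℝ, twistedSum f s α ν t * conj (twistedSum f u β μ t) =
      ∑ i ∈ s, ∑ j ∈ u, ((α i : ℂ) * (β j : ℂ) * (f (ν i) * conj (f (μ j)))) *
        ((ν i : ℂ) ^ (Complex.I * (t : ℂ)) * conj ((μ j : ℂ) ^ (Complex.I * (t : ℂ)))) := by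
    intro t
    rw [twistedSum, twistedSum, map_sum, Finset.sum_mul_sum]
    refine Finset.sum_congr rfl fun i _ => Finset.sum_congr rfl fun j _ => ?_
    simp only [map_mul, Complex.conj_ofReal]
    ring
  simp_rw [e]
  have hint : ∀ i ∈ s, ∀ j ∈ u, Integrable (fun t : ℝ =>
      ((α i : ℂ) * (β j : ℂ) * (f (ν i) * conj (f (μ j)))) *
        ((ν i : ℂ) ^ (Complex.I * (t : ℂ)) * conj ((μ j : ℂ) ^ (Complex.I * (t : ℂ)))))
        (gaussianReal 0 v) :=
    fun i hi j hj => (integrable_cpow_mul_conj v (hν i hi).1 (hμ j hj).1).const_mul _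
  rw [integral_finsetSum _ fun i hi => integrable_finsetSum _ fun j hj => hint i hi j hj]
  rw [Finset.sum_congr rfl fun i hi => integral_finsetSum _ fun j hj => hint i hi j hj]
  rw [diagonalSum]
  push_cast
  rw [← Finset.sum_sub_distrib, Finset.sum_mul_sum, Finset.sum_mul]
  refine (norm_sum_le _ _).trans (Finset.sum_le_sum fun i hi => ?_)
  rw [← Finset.sum_sub_distrib, Finset.sum_mul]
  refine (norm_sum_le _ _).trans (Finset.sum_le_sum fun j hj => ?_)
  obtain ⟨n1, n2⟩ := hν i hi
  obtain ⟨m1, m2⟩ := hμ j hj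
  have ha := hα i hi
  have hb := hβ j hj
  rw [integral_const_mul, integral_gaussianReal_cpow_mul_conj v n1 m1]
  by_cases h : ν i = μ j
  · rw [if_pos h, h, UnimodularCompletelyMultiplicative.conj_mul_self hf m1]
    simp only [sub_self]
    norm_num
    positivity
  · rw [if_neg h]
    simp only [Complex.ofReal_zero, sub_zero, norm_mul, RCLike.norm_conj, hf.2.2 _ n1,
      hf.2.2 _ m1, Complex.norm_real, Real.norm_of_nonneg ha, Real.norm_of_nonneg hb,
      Real.norm_of_nonneg (Real.exp_pos _).le, mul_one]
    refine mul_le_mul_of_nonneg_left (Real.exp_le_exp.2 (neg_le_neg ?_)) (by positivity)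
    have hQ : 0 < Q := lt_of_lt_of_le (by exact_mod_cast n1) n2
    have hl := one_div_le_abs_log_sub_log n1 m1 n2 m2 h
    have h2 : (1 / Q) ^ 2 ≤ (Real.log (ν i) - Real.log (μ j)) ^ 2 := by
      rw [← sq_abs (Real.log (ν i) - _)]
      gcongr
    have h3 : (v : ℝ) / (2 * Q ^ 2) = v * (1 / Q) ^ 2 / 2 := by field_simp
    rw [h3]
    gcongr

theorem integral_normSq_twistedSum_le (hf : f ∈ UnimodularCompletelyMultiplicative)
    (s : Finset ι) {α : ι → ℝ} {ν : ι → ℕ} {Q : ℝ}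
    (hα : ∀ i ∈ s, 0 ≤ α i) (hν : ∀ i ∈ s, 1 ≤ ν i ∧ (ν i : ℝ) ≤ Q) (v : ℝ≥0) :
    ∫ t, ‖twistedSum f s α ν t‖ ^ 2 ∂(gaussianReal 0 v) ≤
      diagonalSum s α ν s α ν + (∑ i ∈ s, α i) ^ 2 * Real.exp (-(v / (2 * Q ^ 2))) := by
  have h := norm_integral_twistedSum_mul_conj_sub_le hf s s hα hα hν hν v
  have e : ∀ t : ℝ, twistedSum f s α ν t * conj (twistedSum f s α ν t) =
      ((‖twistedSum f s α ν t‖ ^ 2 : ℝ) : ℂ) := by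
    intro t
    rw [Complex.mul_conj, Complex.normSq_eq_norm_sq]
  simp_rw [e] at h
  rw [integral_complex_ofReal, ← Complex.ofReal_sub, Complex.norm_real, Real.norm_eq_abs] at h
  have := le_of_abs_le h
  rw [sq (∑ i ∈ s, α i)]
  linarith

/-- Chernoff bound on each tail, with the optimal parameter `±T/v`. -/
theorem gaussianReal_real_abs_gt_le {v : ℝ≥0} (hv : v ≠ 0) {T : ℝ} (hT : 0 < T) :
    (gaussianReal 0 v).real {t : ℝ | T < |t|} ≤ 2 * Real.exp (-(T ^ 2 / (2 * v))) := by
  have hv' : (0 : ℝ) < v := lt_of_le_of_ne v.2 (by exact_mod_cast hv.symm)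
  have hint : ∀ t : ℝ, Integrable (fun x : ℝ => Real.exp (t * x)) (gaussianReal 0 v) :=
    fun t => integrable_exp_mul_gaussianReal t
  have hm : ∀ t : ℝ, mgf id (gaussianReal 0 v) t = Real.exp (v * t ^ 2 / 2) := by
    intro t
    rw [mgf_gaussianReal (μ := 0) (v := v) (by simp)]
    simp
  have h1 := measure_ge_le_exp_mul_mgf (X := id) (μ := gaussianReal 0 v) T
    (t := T / v) (by positivity) (hint _)
  have h2 := measure_le_le_exp_mul_mgf (X := id) (μ := gaussianReal 0 v) (-T)
    (t := -(T / v)) (by rw [neg_nonpos]; positivity) (hint _)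
  rw [hm, ← Real.exp_add] at h1 h2
  have e1 : -(T / v) * T + v * (T / v) ^ 2 / 2 = -(T ^ 2 / (2 * v)) := by field_simp; ring
  have e2 : - -(T / v) * -T + v * (-(T / v)) ^ 2 / 2 = -(T ^ 2 / (2 * v)) := by field_simp; ring
  rw [e1] at h1
  rw [e2] at h2
  have hsub : {t : ℝ | T < |t|} ⊆ {t | T ≤ id t} ∪ {t | id t ≤ -T} := by
    intro t ht
    rcases lt_abs.1 (show T < |t| from ht) with h | h
    · exact Or.inl h.le
    · exact Or.inr (by simp only [id, Set.mem_ofPred_eq]; linarith)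
  have := (measureReal_mono (μ := gaussianReal 0 v) hsub).trans (measureReal_union_le _ _)
  linarith

/-! ### The resonance inequality. -/

theorem norm_dirichletPoly_le (hf : f ∈ UnimodularCompletelyMultiplicative) {N : ℕ} (hN : 1 ≤ N)
    (t : ℝ) : ‖dirichletPoly f N t‖ ≤ Real.sqrt N := by
  have hN' : (0 : ℝ) < N := by exact_mod_cast hN
  have hs := Real.sqrt_pos.2 hN'
  rw [dirichletPoly, norm_mul]
  have h1 : ‖∑ n ∈ Finset.Icc 1 N, f n * (n : ℂ) ^ (Complex.I * (t : ℂ))‖ ≤ N := by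
    refine (norm_sum_le _ _).trans ?_
    rw [Finset.sum_congr rfl fun n hn => by
      rw [norm_mul, hf.2.2 n (Finset.mem_Icc.1 hn).1,
        norm_natCast_cpow_I_mul (Finset.mem_Icc.1 hn).1, mul_one]]
    simp
  rw [norm_div, norm_one, Complex.norm_real, Real.norm_of_nonneg hs.le]
  calc 1 / Real.sqrt N * _ ≤ 1 / Real.sqrt N * N := by gcongr
    _ = Real.sqrt N := by
      rw [one_div_mul_eq_div, div_eq_iff hs.ne', Real.mul_self_sqrt hN'.le]

theorem norm_dirichletPoly_le_sup (hf : f ∈ UnimodularCompletelyMultiplicative) {N : ℕ}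
    (hN : 1 ≤ N) {t T : ℝ} (ht : |t| ≤ T) :
    ‖dirichletPoly f N t‖ ≤ supDirichletPoly f N T := by
  refine le_csSup ⟨Real.sqrt N, ?_⟩ ⟨t, ht, rfl⟩
  rintro _ ⟨t, _, rfl⟩
  exact norm_dirichletPoly_le hf hN t

theorem sqrt_mul_dirichletPoly_mul_twistedSum (hf : f ∈ UnimodularCompletelyMultiplicative) {N : ℕ}
    (hN : 1 ≤ N) (s : Finset ι) {α : ι → ℝ} {ν : ι → ℕ} (hν : ∀ i ∈ s, 1 ≤ ν i) (t : ℝ) :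
    (Real.sqrt N : ℂ) * dirichletPoly f N t * twistedSum f s α ν t =
      twistedSum f (Finset.Icc 1 N ×ˢ s) (fun x => α x.2) (fun x => x.1 * ν x.2) t := by
  have hs : (Real.sqrt N : ℂ) ≠ 0 := by
    exact_mod_cast (Real.sqrt_pos.2 (by exact_mod_cast hN : (0 : ℝ) < N)).ne'
  rw [dirichletPoly, ← mul_assoc, mul_one_div_cancel hs, one_mul, twistedSum, twistedSum,
    Finset.sum_mul_sum, Finset.sum_product]
  refine Finset.sum_congr rfl fun n hn => Finset.sum_congr rfl fun i hi => ?_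
  have h1 := (Finset.mem_Icc.1 hn).1
  have h2 := hν i hi
  simp only
  rw [hf.2.1 _ _ h1 h2, Nat.cast_mul, Complex.natCast_mul_natCast_cpow]
  ring

/-- The resonance inequality with two resonators. -/
theorem resonance_inequality (hf : f ∈ UnimodularCompletelyMultiplicative) {N : ℕ} (hN : 1 ≤ N)
    {T Q : ℝ} (hT : 0 < T) {v : ℝ≥0} (hv : v ≠ 0)
    (s : Finset ι) (u : Finset κ) {α : ι → ℝ} {ν : ι → ℕ} {β : κ → ℝ} {μ : κ → ℕ}
    (hα : ∀ i ∈ s, 0 ≤ α i) (hβ : ∀ j ∈ u, 0 ≤ β j)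
    (hν : ∀ i ∈ s, 1 ≤ ν i ∧ (N : ℝ) * ν i ≤ Q)
    (hμ : ∀ j ∈ u, 1 ≤ μ j ∧ (μ j : ℝ) ≤ Q) :
    diagonalSum (Finset.Icc 1 N ×ˢ s) (fun x => α x.2) (fun x => x.1 * ν x.2) u β μ ≤
      Real.sqrt N * (supDirichletPoly f N T *
        ((diagonalSum s α ν s α ν + diagonalSum u β μ u β μ +
          ((∑ i ∈ s, α i) ^ 2 + (∑ j ∈ u, β j) ^ 2) * Real.exp (-(v / (2 * Q ^ 2)))) / 2)) +
      N * (∑ i ∈ s, α i) * (∑ j ∈ u, β j) *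
        (Real.exp (-(v / (2 * Q ^ 2))) + 2 * Real.exp (-(T ^ 2 / (2 * v)))) := by
  set P := gaussianReal 0 v with hP
  set ε := Real.exp (-(v / (2 * Q ^ 2))) with hε
  set a := ∑ i ∈ s, α i with ha
  set b := ∑ j ∈ u, β j with hb
  set B := supDirichletPoly f N T with hB
  have hN' : (1 : ℝ) ≤ N := by exact_mod_cast hN
  have ha0 : 0 ≤ a := Finset.sum_nonneg hα
  have hb0 : 0 ≤ b := Finset.sum_nonneg hβ
  have hB0 : 0 ≤ B := (norm_nonneg _).trans (norm_dirichletPoly_le_sup hf hN (t := 0) (by simpa using hT.le))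
  have hν1 : ∀ i ∈ s, 1 ≤ ν i ∧ (ν i : ℝ) ≤ Q := fun i hi => ⟨(hν i hi).1,
    le_trans (by nlinarith [(Nat.cast_nonneg (ν i) : (0 : ℝ) ≤ ν i)]) (hν i hi).2⟩
  have hprod : ∀ x ∈ Finset.Icc 1 N ×ˢ s, 1 ≤ x.1 * ν x.2 ∧ ((x.1 * ν x.2 : ℕ) : ℝ) ≤ Q := by
    intro x hx
    rw [Finset.mem_product, Finset.mem_Icc] at hx
    refine ⟨Nat.mul_pos hx.1.1 (hν _ hx.2).1, le_trans ?_ (hν _ hx.2).2⟩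
    rw [Nat.cast_mul]
    gcongr
    exact_mod_cast hx.1.2
  have h1 := norm_integral_twistedSum_mul_conj_sub_le hf (Finset.Icc 1 N ×ˢ s) u
    (α := fun x => α x.2) (ν := fun x => x.1 * ν x.2) (Q := Q)
    (fun x hx => hα _ (Finset.mem_product.1 hx).2) hβ hprod hμ v
  have hsum : ∑ x ∈ Finset.Icc 1 N ×ˢ s, α x.2 = N * a := by
    rw [Finset.sum_product]; simp [ha]
  rw [hsum, ← hP, ← hε, ← hb] at h1
  have hR := integral_normSq_twistedSum_le hf s hα hν1 v
  have hS := integral_normSq_twistedSum_le hf u hβ hμ v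
  have cR := continuous_twistedSum (f := f) s (α := α) fun i hi => (hν i hi).1
  have cS := continuous_twistedSum (f := f) u (α := β) fun j hj => (hμ j hj).1
  have bR := norm_twistedSum_le hf s hα fun i hi => (hν i hi).1
  have bS := norm_twistedSum_le hf u hβ fun j hj => (hμ j hj).1
  have iR : Integrable (fun t => ‖twistedSum f s α ν t‖ ^ 2) P :=
    Integrable.of_bound (C := a ^ 2) (by fun_prop) (Eventually.of_forall fun t => by
      rw [Real.norm_of_nonneg (by positivity)]
      exact pow_le_pow_left₀ (norm_nonneg _) (bR t) 2)
  have iS : Integrable (fun t => ‖twistedSum f u β μ t‖ ^ 2) P :=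
    Integrable.of_bound (C := b ^ 2) (by fun_prop) (Eventually.of_forall fun t => by
      rw [Real.norm_of_nonneg (by positivity)]
      exact pow_le_pow_left₀ (norm_nonneg _) (bS t) 2)
  have hmeas : MeasurableSet {t : ℝ | T < |t|} :=
    measurableSet_lt measurable_const (by fun_prop)
  have iI : Integrable ({t : ℝ | T < |t|}.indicator fun _ => (N : ℝ) * a * b) P :=
    (integrable_const _).indicator hmeas
  have iRS : Integrable (fun t => Real.sqrt N * B / 2 *
      (‖twistedSum f s α ν t‖ ^ 2 + ‖twistedSum f u β μ t‖ ^ 2)) P := (iR.add iS).const_mul _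
  have h2 : ‖∫ t, twistedSum f (Finset.Icc 1 N ×ˢ s) (fun x => α x.2) (fun x => x.1 * ν x.2) t *
      conj (twistedSum f u β μ t) ∂P‖ ≤
      ∫ t, (Real.sqrt N * B / 2 * (‖twistedSum f s α ν t‖ ^ 2 + ‖twistedSum f u β μ t‖ ^ 2) +
        {t : ℝ | T < |t|}.indicator (fun _ => (N : ℝ) * a * b) t) ∂P := by
    refine norm_integral_le_of_norm_le (iRS.add iI)
      (Eventually.of_forall fun t => ?_)
    rw [← sqrt_mul_dirichletPoly_mul_twistedSum hf hN s fun i hi => (hν i hi).1]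
    rw [norm_mul, norm_mul, norm_mul, RCLike.norm_conj, Complex.norm_real,
      Real.norm_of_nonneg (Real.sqrt_nonneg _)]
    have hx := norm_nonneg (twistedSum f s α ν t)
    have hy := norm_nonneg (twistedSum f u β μ t)
    have bx := bR t
    have bY := bS t
    have hsq : Real.sqrt N * Real.sqrt N = N := Real.mul_self_sqrt (by linarith)
    have hs0 := Real.sqrt_nonneg (N : ℝ)
    set x := ‖twistedSum f s α ν t‖
    set y := ‖twistedSum f u β μ t‖
    -- This replaces Cauchy–Schwarz. The two mean squares will differ by at most a factor of order
    -- `log N`, which is affordable.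
    have hxy : x * y ≤ (x ^ 2 + y ^ 2) / 2 := by nlinarith [sq_nonneg (x - y)]
    -- Beyond `T` only the trivial bound `‖D‖ ≤ √N` is available; the Gaussian tail pays for it.
    by_cases ht : T < |t|
    · rw [Set.indicator_of_mem (show t ∈ {t : ℝ | T < |t|} from ht)]
      have hD := norm_dirichletPoly_le hf hN t
      have : Real.sqrt N * ‖dirichletPoly f N t‖ * x * y ≤ Real.sqrt N * Real.sqrt N * a * b := by
        gcongr
      rw [hsq] at this
      have : 0 ≤ Real.sqrt N * B / 2 * (x ^ 2 + y ^ 2) := by positivity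
      linarith
    · rw [Set.indicator_of_notMem (show t ∉ {t : ℝ | T < |t|} from ht)]
      have hD := norm_dirichletPoly_le_sup hf hN (not_lt.1 ht)
      calc Real.sqrt N * ‖dirichletPoly f N t‖ * x * y
          = Real.sqrt N * ‖dirichletPoly f N t‖ * (x * y) := by ring
        _ ≤ Real.sqrt N * B * ((x ^ 2 + y ^ 2) / 2) := by gcongr
        _ = _ := by ring
  rw [integral_add iRS iI, integral_const_mul, integral_add iR iS,
    integral_indicator hmeas, setIntegral_const, smul_eq_mul] at h2
  have h3 := gaussianReal_real_abs_gt_le hv hT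
  have h4 : diagonalSum (Finset.Icc 1 N ×ˢ s) (fun x => α x.2) (fun x => x.1 * ν x.2) u β μ ≤
      ‖∫ t, twistedSum f (Finset.Icc 1 N ×ˢ s) (fun x => α x.2) (fun x => x.1 * ν x.2) t *
      conj (twistedSum f u β μ t) ∂P‖ + N * a * b * ε := by
    have := norm_sub_norm_le ((diagonalSum (Finset.Icc 1 N ×ˢ s) (fun x => α x.2)
      (fun x => x.1 * ν x.2) u β μ : ℝ) : ℂ) (∫ t, twistedSum f (Finset.Icc 1 N ×ˢ s)
      (fun x => α x.2) (fun x => x.1 * ν x.2) t * conj (twistedSum f u β μ t) ∂P)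
    rw [norm_sub_rev, Complex.norm_real] at this
    have h := Real.le_norm_self (diagonalSum (Finset.Icc 1 N ×ˢ s) (fun x => α x.2)
      (fun x => x.1 * ν x.2) u β μ)
    linarith
  have h5 : P.real {t : ℝ | T < |t|} * (N * a * b) ≤
      2 * Real.exp (-(T ^ 2 / (2 * v))) * (N * a * b) := by gcongr
  have h6 : Real.sqrt N * B / 2 * (∫ t, ‖twistedSum f s α ν t‖ ^ 2 ∂P +
      ∫ t, ‖twistedSum f u β μ t‖ ^ 2 ∂P) ≤ Real.sqrt N * B / 2 *
      ((diagonalSum s α ν s α ν + a ^ 2 * ε) + (diagonalSum u β μ u β μ + b ^ 2 * ε)) := by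
    gcongr
  calc _ ≤ _ := h4.trans (add_le_add_left (h2.trans (add_le_add h6 h5)) _)
    _ = _ := by ring

end Mean

/-! ### Product weights on subsets and their truncation. -/

section Powerset

variable {ι : Type*} [DecidableEq ι]

/-- After division by the total mass `∏(1 + x i)`, the weights make the events `i ∈ B` independent
with probability `x i/(1 + x i)`; this is the mean of `∑ i ∈ B, w i`. -/
theorem sum_powerset_prod_mul_sum (P : Finset ι) {x : ι → ℝ} (w : ι → ℝ)
    (hx : ∀ i ∈ P, 0 ≤ x i) :
    ∑ B ∈ P.powerset, (∏ i ∈ B, x i) * ∑ i ∈ B, w i =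
      (∏ i ∈ P, (1 + x i)) * ∑ i ∈ P, w i * (x i / (1 + x i)) := by
  induction P using Finset.induction_on with
  | empty => simp
  | insert a P ha ih =>
    have ih := ih fun i hi => hx i (Finset.mem_insert_of_mem hi)
    have hxa := hx a (Finset.mem_insert_self a P)
    have h0 : 1 + x a ≠ 0 := by positivity
    rw [Finset.sum_powerset_insert ha, ih, Finset.prod_insert ha, Finset.sum_insert ha]
    have e : ∀ B ∈ P.powerset, (∏ i ∈ insert a B, x i) * ∑ i ∈ insert a B, w i =
        x a * w a * (∏ i ∈ B, x i) + x a * ((∏ i ∈ B, x i) * ∑ i ∈ B, w i) := by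
      intro B hB
      have : a ∉ B := fun h => ha (Finset.mem_powerset.1 hB h)
      rw [Finset.prod_insert this, Finset.sum_insert this]
      ring
    rw [Finset.sum_congr rfl e, Finset.sum_add_distrib, ← Finset.mul_sum, ← Finset.mul_sum, ih,
      ← Finset.prod_one_add]
    field_simp
    ring

/-- A Markov inequality for the weights `∏_{i ∈ B} r i ^ 2 * ∏_{i ∈ A} z i`, `A ⊆ B ⊆ P`. -/
theorem le_sum_powerset_filter_of_markov (P : Finset ι) {r z w : ι → ℝ} {a b : ℝ}
    (ha : 0 < a) (hb : 0 < b) (hz : ∀ i ∈ P, 0 ≤ z i) (hw : ∀ i ∈ P, 0 ≤ w i) :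
    (∏ i ∈ P, (1 + r i ^ 2 * (1 + z i))) *
        (1 - (∑ i ∈ P, w i * (r i ^ 2 * (1 + z i))) / a - (∑ i ∈ P, w i * (r i ^ 2 * z i)) / b) ≤
      ∑ B ∈ P.powerset with ∑ i ∈ B, w i ≤ a,
        ∑ A ∈ B.powerset with ∑ i ∈ A, w i ≤ b, (∏ i ∈ B, r i ^ 2) * ∏ i ∈ A, z i := by
  have hsub : ∀ B ∈ P.powerset, ∀ i ∈ B, i ∈ P := fun B hB i hi => Finset.mem_powerset.1 hB hi
  -- Pointwise Markov: `1 - x/a - y/b` is at most the indicator of `x ≤ a` and `y ≤ b` for `x, y ≥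
  -- 0`.
  have hpt : ∀ B ∈ P.powerset, ∀ A ∈ B.powerset,
      (∏ i ∈ B, r i ^ 2) * (∏ i ∈ A, z i) * (1 - (∑ i ∈ B, w i) / a - (∑ i ∈ A, w i) / b) ≤
      if ∑ i ∈ B, w i ≤ a then if ∑ i ∈ A, w i ≤ b then (∏ i ∈ B, r i ^ 2) * ∏ i ∈ A, z i else 0
        else 0 := by
    intro B hB A hA
    have h1 : 0 ≤ (∏ i ∈ B, r i ^ 2) * ∏ i ∈ A, z i :=
      mul_nonneg (Finset.prod_nonneg fun i _ => sq_nonneg _)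
        (Finset.prod_nonneg fun i hi => hz i (hsub B hB i (Finset.mem_powerset.1 hA hi)))
    have h2 : 0 ≤ (∑ i ∈ B, w i) / a :=
      div_nonneg (Finset.sum_nonneg fun i hi => hw i (hsub B hB i hi)) ha.le
    have h3 : 0 ≤ (∑ i ∈ A, w i) / b :=
      div_nonneg (Finset.sum_nonneg fun i hi =>
        hw i (hsub B hB i (Finset.mem_powerset.1 hA hi))) hb.le
    split_ifs with c1 c2
    · nlinarith
    · have : 1 < (∑ i ∈ A, w i) / b := by rw [one_lt_div hb]; linarith
      nlinarith
    · have : 1 < (∑ i ∈ B, w i) / a := by rw [one_lt_div ha]; linarith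
      nlinarith
  simp_rw [Finset.sum_filter]
  have hle : ∑ B ∈ P.powerset, ∑ A ∈ B.powerset,
      (∏ i ∈ B, r i ^ 2) * (∏ i ∈ A, z i) * (1 - (∑ i ∈ B, w i) / a - (∑ i ∈ A, w i) / b) ≤
      ∑ B ∈ P.powerset, if ∑ i ∈ B, w i ≤ a then ∑ A ∈ B.powerset,
        if ∑ i ∈ A, w i ≤ b then (∏ i ∈ B, r i ^ 2) * ∏ i ∈ A, z i else 0 else 0 := by
    refine Finset.sum_le_sum fun B hB => ?_
    refine (Finset.sum_le_sum fun A hA => hpt B hB A hA).trans (le_of_eq ?_)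
    split_ifs <;> simp
  refine le_trans ?_ hle
  -- Summing out `A ⊆ B` leaves product weights `r² (1 + z)` on `B`; given `B`, each `i ∈ B` lies in
  -- `A` with probability `z/(1 + z)`.
  have hinner : ∀ B ∈ P.powerset, ∑ A ∈ B.powerset,
      (∏ i ∈ B, r i ^ 2) * (∏ i ∈ A, z i) * (1 - (∑ i ∈ B, w i) / a - (∑ i ∈ A, w i) / b) =
      (∏ i ∈ B, r i ^ 2 * (1 + z i)) -
        ((∏ i ∈ B, r i ^ 2 * (1 + z i)) * ∑ i ∈ B, w i) / a -
        ((∏ i ∈ B, r i ^ 2 * (1 + z i)) * ∑ i ∈ B, w i * (z i / (1 + z i))) / b := by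
    intro B hB
    have e := sum_powerset_prod_mul_sum B w fun i hi => hz i (hsub B hB i hi)
    have e2 : ∀ A ∈ B.powerset,
        (∏ i ∈ B, r i ^ 2) * (∏ i ∈ A, z i) * (1 - (∑ i ∈ B, w i) / a - (∑ i ∈ A, w i) / b) =
        (∏ i ∈ B, r i ^ 2) * (1 - (∑ i ∈ B, w i) / a) * (∏ i ∈ A, z i) -
          (∏ i ∈ B, r i ^ 2) / b * ((∏ i ∈ A, z i) * ∑ i ∈ A, w i) := by
      intro A _
      ring
    rw [Finset.sum_congr rfl e2, Finset.sum_sub_distrib, ← Finset.mul_sum, ← Finset.mul_sum, e,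
      ← Finset.prod_one_add, Finset.prod_mul_distrib]
    ring
  rw [Finset.sum_congr rfl hinner, Finset.sum_sub_distrib, Finset.sum_sub_distrib,
    ← Finset.sum_div, ← Finset.sum_div]
  have hx : ∀ i ∈ P, 0 ≤ r i ^ 2 * (1 + z i) := fun i hi => by have := hz i hi; positivity
  rw [sum_powerset_prod_mul_sum P w hx, sum_powerset_prod_mul_sum P _ hx, ← Finset.prod_one_add,
    mul_div_assoc, mul_div_assoc, ← mul_one_sub, ← mul_sub]
  refine mul_le_mul_of_nonneg_left ?_ (Finset.prod_nonneg fun i hi => by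
    have := hx i hi; positivity)
  have b1 : ∑ i ∈ P, w i * (r i ^ 2 * (1 + z i) / (1 + r i ^ 2 * (1 + z i))) ≤
      ∑ i ∈ P, w i * (r i ^ 2 * (1 + z i)) := by
    refine Finset.sum_le_sum fun i hi => mul_le_mul_of_nonneg_left ?_ (hw i hi)
    have := hx i hi
    exact div_le_self this (by linarith)
  have b2 : ∑ i ∈ P, w i * (z i / (1 + z i)) *
      (r i ^ 2 * (1 + z i) / (1 + r i ^ 2 * (1 + z i))) ≤ ∑ i ∈ P, w i * (r i ^ 2 * z i) := by
    refine Finset.sum_le_sum fun i hi => ?_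
    have h := hx i hi
    have h1 := hz i hi
    rw [mul_assoc]
    refine mul_le_mul_of_nonneg_left ?_ (hw i hi)
    calc z i / (1 + z i) * (r i ^ 2 * (1 + z i) / (1 + r i ^ 2 * (1 + z i)))
        ≤ z i / (1 + z i) * (r i ^ 2 * (1 + z i)) := by
          refine mul_le_mul_of_nonneg_left (div_le_self h (by linarith)) (by positivity)
      _ = r i ^ 2 * z i := by field_simp
  have := div_le_div_of_nonneg_right b1 ha.le
  have := div_le_div_of_nonneg_right b2 hb.le
  linarith

end Powerset

/-! ### Diagonal terms of the two resonators. -/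

theorem diagonalSum_self {ι : Type*} (s : Finset ι) (α : ι → ℝ) {ν : ι → ℕ}
    (hν : Set.InjOn ν s) : diagonalSum s α ν s α ν = ∑ i ∈ s, α i ^ 2 := by
  classical
  refine Finset.sum_congr rfl fun i hi => ?_
  have : ∀ j ∈ s, (if ν i = ν j then α i * α j else 0) = if i = j then α i * α j else 0 := by
    intro j hj
    exact if_congr ⟨fun h => hν hi hj h, fun h => by rw [h]⟩ rfl rfl
  rw [Finset.sum_congr rfl this, Finset.sum_ite_eq, if_pos hi, sq]

/-- The prime factors of the product are `B` together with `g`, and disjointness of `G` and `P`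
tells which one is `g`. Hence the mean square of the second resonator has no repeated frequencies.
-/
theorem injOn_mul_prod_primes {P G : Finset ℕ} (hP : ∀ p ∈ P, p.Prime) (hG : ∀ g ∈ G, g.Prime)
    (hGP : Disjoint G P) :
    Set.InjOn (fun x : ℕ × Finset ℕ => x.1 * ∏ p ∈ x.2, p) (G ×ˢ P.powerset : Finset _) := by
  have key : ∀ x ∈ G ×ˢ P.powerset, (x.1 * ∏ p ∈ x.2, p).primeFactors = insert x.1 x.2 := by
    intro x hx
    rw [Finset.mem_product, Finset.mem_powerset] at hx
    have hn : x.1 ∉ x.2 := fun h => Finset.disjoint_left.1 hGP hx.1 (hx.2 h)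
    rw [← Finset.prod_insert (f := fun p => p) hn]
    refine Nat.primeFactors_prod fun p hp => ?_
    rcases Finset.mem_insert.1 hp with rfl | h
    · exact hG _ hx.1
    · exact hP _ (hx.2 h)
  intro x hx y hy hxy
  have hins : insert x.1 x.2 = insert y.1 y.2 := by
    rw [← key x hx, ← key y hy]
    exact congrArg _ hxy
  rw [Finset.mem_coe, Finset.mem_product, Finset.mem_powerset] at hx hy
  have hxP := Finset.disjoint_left.1 hGP hx.1
  have hyP := Finset.disjoint_left.1 hGP hy.1
  have h1 : x.1 = y.1 := by
    have : x.1 ∈ insert y.1 y.2 := hins ▸ Finset.mem_insert_self _ _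
    exact (Finset.mem_insert.1 this).resolve_right fun h => hxP (hy.2 h)
  refine Prod.ext h1 ?_
  rw [h1] at hins
  rw [← Finset.erase_insert (fun h => hxP (hx.2 (h1 ▸ h)) : y.1 ∉ x.2), hins,
    Finset.erase_insert fun h => hyP (hy.2 h)]

theorem injOn_prod_primes {P : Finset ℕ} (hP : ∀ p ∈ P, p.Prime) :
    Set.InjOn (fun B : Finset ℕ => ∏ p ∈ B, p) (P.powerset : Set (Finset ℕ)) := by
  intro x hx y hy hxy
  rw [Finset.mem_coe, Finset.mem_powerset] at hx hy
  rw [← Nat.primeFactors_prod fun p hp => hP p (hx hp),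
    ← Nat.primeFactors_prod fun p hp => hP p (hy hp)]
  exact congrArg _ hxy

theorem prod_cast_eq_exp_sum_log {B : Finset ℕ} (hB : ∀ p ∈ B, p.Prime) :
    ((∏ p ∈ B, p : ℕ) : ℝ) = Real.exp (∑ p ∈ B, Real.log p) := by
  rw [Real.exp_sum, Nat.cast_prod]
  refine Finset.prod_congr rfl fun p hp => ?_
  rw [Real.exp_log (by exact_mod_cast (hB p hp).pos)]

/-- Lower bound for the diagonal terms of `√N · D · R · conj S`. -/
theorem le_diagonalSum_resonators {N : ℕ} {P G : Finset ℕ}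
    (hP : ∀ p ∈ P, p.Prime) (hG : ∀ g ∈ G, g.Prime) {r : ℕ → ℝ} (hr : ∀ p ∈ P, 0 < r p) {a b c : ℝ}
    (hc : ∀ x : ℝ, N * Real.exp (-b) ≤ x → x ≤ N →
      c * Real.sqrt x ≤ ∑ g ∈ G with ((g : ℕ) : ℝ) ≤ x, 1 / Real.sqrt g) :
    c * Real.sqrt N * ∑ B ∈ P.powerset with ∑ p ∈ B, Real.log (p : ℕ) ≤ a,
        ∑ A ∈ B.powerset with ∑ p ∈ A, Real.log (p : ℕ) ≤ b,
          (∏ p ∈ B, r p ^ 2) * ∏ p ∈ A, 1 / (r p * Real.sqrt p) ≤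
      diagonalSum (Finset.Icc 1 N ×ˢ {B ∈ P.powerset | ∑ p ∈ B, Real.log (p : ℕ) ≤ a})
        (fun x => ∏ p ∈ x.2, r p) (fun x => x.1 * ∏ p ∈ x.2, p)
        (G ×ˢ {B ∈ P.powerset | ∑ p ∈ B, Real.log (p : ℕ) ≤ a})
        (fun x => 1 / Real.sqrt x.1 * ∏ p ∈ x.2, r p) (fun x => x.1 * ∏ p ∈ x.2, p) := by
  set BB : Finset (Finset ℕ) := {B ∈ P.powerset | ∑ p ∈ B, Real.log (p : ℕ) ≤ a} with hBB
  have hlog : ∀ p : ℕ, 0 ≤ Real.log p := Real.log_natCast_nonneg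
  have hBP : ∀ B ∈ BB, B ⊆ P := fun B hB =>
    Finset.mem_powerset.1 (Finset.mem_filter.1 hB).1
  have hprodpos : ∀ B ⊆ P, 0 < ∏ p ∈ B, r p := fun B hB =>
    Finset.prod_pos fun p hp => hr p (hB hp)
  rw [diagonalSum, Finset.sum_comm, Finset.sum_product_right, Finset.mul_sum]
  refine Finset.sum_le_sum fun B hB => ?_
  have hBsub := hBP B hB
  -- For fixed `g` and `B`, each admissible `A ⊆ B` gives the solution `(gA)·(B/A) = g·B`. Different
  -- `A` give different pairs, and all other terms are nonnegative.
  have hstep : ∀ g ∈ G, ∑ A ∈ B.powerset with ∑ p ∈ A, Real.log (p : ℕ) ≤ b,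
      (if (g : ℝ) ≤ N / (∏ p ∈ A, p : ℕ) then
        (∏ p ∈ B \ A, r p) * (1 / Real.sqrt g * ∏ p ∈ B, r p) else 0) ≤
      ∑ x ∈ Finset.Icc 1 N ×ˢ BB, if x.1 * ∏ p ∈ x.2, p = g * ∏ p ∈ B, p then
        (∏ p ∈ x.2, r p) * (1 / Real.sqrt g * ∏ p ∈ B, r p) else 0 := by
    intro g hg
    rw [← Finset.sum_filter]
    set F := {A ∈ {A ∈ B.powerset | ∑ p ∈ A, Real.log (p : ℕ) ≤ b} | (g : ℝ) ≤ N / (∏ p ∈ A, p : ℕ)}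
      with hF
    have hFB : ∀ A ∈ F, A ⊆ B := fun A hA =>
      Finset.mem_powerset.1 (Finset.mem_filter.1 (Finset.mem_filter.1 hA).1).1
    have hinj : Set.InjOn (fun A : Finset ℕ => (g * ∏ p ∈ A, p, B \ A)) F := by
      intro A hA A' hA' h
      have h2 : B \ A = B \ A' := (Prod.ext_iff.1 h).2
      rw [← Finset.sdiff_sdiff_eq_self (hFB A hA), h2, Finset.sdiff_sdiff_eq_self (hFB A' hA')]
    have hprod : ∀ A ∈ F, (g * ∏ p ∈ A, p) * ∏ p ∈ B \ A, p = g * ∏ p ∈ B, p := by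
      intro A hA
      rw [mul_assoc, mul_comm (∏ p ∈ A, p), Finset.prod_sdiff (hFB A hA)]
    have e : ∑ A ∈ F, (∏ p ∈ B \ A, r p) * (1 / Real.sqrt g * ∏ p ∈ B, r p) =
        ∑ x ∈ F.image (fun A : Finset ℕ => (g * ∏ p ∈ A, p, B \ A)),
          if x.1 * ∏ p ∈ x.2, p = g * ∏ p ∈ B, p then
            (∏ p ∈ x.2, r p) * (1 / Real.sqrt g * ∏ p ∈ B, r p) else 0 := by
      rw [Finset.sum_image hinj]
      refine Finset.sum_congr rfl fun A hA => ?_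
      rw [if_pos (hprod A hA)]
    rw [e]
    refine Finset.sum_le_sum_of_subset_of_nonneg ?_ ?_
    · intro x hx
      obtain ⟨A, hA, rfl⟩ := Finset.mem_image.1 hx
      have hAP : ∀ p ∈ A, p.Prime := fun p hp => hP p (hBsub (hFB A hA hp))
      have hApos : 0 < ∏ p ∈ A, p := Finset.prod_pos fun p hp => (hAP p hp).pos
      have h2 := (Finset.mem_filter.1 hA).2
      rw [le_div_iff₀ (by exact_mod_cast hApos)] at h2
      rw [Finset.mem_product, Finset.mem_Icc]
      refine ⟨⟨Nat.mul_pos (hG g hg).pos hApos, by exact_mod_cast h2⟩, ?_⟩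
      rw [hBB, Finset.mem_filter, Finset.mem_powerset]
      refine ⟨Finset.sdiff_subset.trans hBsub, le_trans ?_ (Finset.mem_filter.1 hB).2⟩
      exact Finset.sum_le_sum_of_subset_of_nonneg Finset.sdiff_subset fun p _ _ => hlog p
    · intro x hx _
      split_ifs with h
      · have := hprodpos x.2 (hBP _ (Finset.mem_product.1 hx).2)
        have := hprodpos B hBsub
        positivity
      · exact le_rfl
  refine le_trans ?_ (Finset.sum_le_sum hstep)
  rw [Finset.sum_comm, Finset.mul_sum]
  refine Finset.sum_le_sum fun A hA => ?_
  rw [Finset.mem_filter, Finset.mem_powerset] at hA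
  have hAP : ∀ p ∈ A, p.Prime := fun p hp => hP p (hBsub (hA.1 hp))
  have hApos : (1 : ℝ) ≤ (∏ p ∈ A, p : ℕ) := by
    exact_mod_cast Finset.prod_pos fun p hp => (hAP p hp).pos
  -- The truncation `A ≤ e^b` is what puts `N/A` in the range where `hc` applies.
  have hcA := hc (N / (∏ p ∈ A, p : ℕ)) (by
      rw [prod_cast_eq_exp_sum_log hAP, div_eq_mul_inv, ← Real.exp_neg]
      gcongr
      exact hA.2) (div_le_self (by positivity) hApos)
  have hrA := hprodpos A (hA.1.trans hBsub)
  have hrBA := hprodpos (B \ A) (Finset.sdiff_subset.trans hBsub)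
  have hrB : (∏ p ∈ B, r p) = (∏ p ∈ B \ A, r p) * ∏ p ∈ A, r p := (Finset.prod_sdiff hA.1).symm
  have hsq : Real.sqrt (∏ p ∈ A, p : ℕ) = ∏ p ∈ A, Real.sqrt p := by
    rw [Nat.cast_prod, Real.sqrt_prod _ fun p _ => by positivity]
  rw [← Finset.sum_filter]
  calc c * Real.sqrt N * ((∏ p ∈ B, r p ^ 2) * ∏ p ∈ A, 1 / (r p * Real.sqrt p))
      = (∏ p ∈ B \ A, r p) * (∏ p ∈ B, r p) * (c * Real.sqrt (N / (∏ p ∈ A, p : ℕ))) := by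
        rw [Real.sqrt_div (by positivity), hsq, Finset.prod_pow, Finset.prod_div_distrib,
          Finset.prod_mul_distrib, Finset.prod_const_one]
        have hs : (∏ p ∈ A, Real.sqrt p) ≠ 0 := by
          rw [← hsq]
          exact (Real.sqrt_pos.2 (by linarith)).ne'
        rw [hrB]
        field_simp
    _ ≤ (∏ p ∈ B \ A, r p) * (∏ p ∈ B, r p) *
        ∑ g ∈ G with ((g : ℕ) : ℝ) ≤ N / (∏ p ∈ A, p : ℕ), 1 / Real.sqrt g := by
        have := hprodpos B hBsub
        gcongr
    _ = _ := by
        rw [Finset.mul_sum]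
        exact Finset.sum_congr rfl fun g _ => by ring

/-! ### The lower bound with free parameters. -/

/-- Division of the resonance inequality by `√N · U`; since all the coefficient sums are at most
`Q`, the total error is at most `1`. -/
theorem lower_bound_of_resonance_inequality {n s D U W H ρ c Q α β ε τ dR dS : ℝ} (hs1 : 1 ≤ s)
    (hs2 : s * s = n) (hD0 : 0 ≤ D) (hDs : D ≤ s) (hU1 : 1 ≤ U) (hQn : n ≤ Q) (hα0 : 0 ≤ α)
    (hα : α ≤ Q) (hβ0 : 0 ≤ β) (hβ : β ≤ Q) (hε0 : 0 ≤ ε) (hτ0 : 0 ≤ τ) (hdR : dR ≤ U)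
    (hdS : dS ≤ H * U)
    (h : c * s * (U * W * ρ) ≤
      s * (D * ((dR + dS + (α ^ 2 + β ^ 2) * ε) / 2)) + n * α * β * (ε + 2 * τ))
    (herr : Q ^ 3 * (2 * ε + 2 * τ) ≤ 1) : c * ρ * W ≤ D * ((1 + H) / 2) + 1 := by
  have hQ0 : 0 ≤ Q := hα0.trans hα
  have hsQ : s ≤ Q := by nlinarith
  have hα2 : α ^ 2 ≤ Q ^ 2 := by gcongr
  have hβ2 : β ^ 2 ≤ Q ^ 2 := by gcongr
  have hαβ : α * β ≤ Q ^ 2 := by rw [sq]; gcongr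
  have h2 : D * ((U + H * U + (Q ^ 2 + Q ^ 2) * ε) / 2) ≤ D * (U * (1 + H) / 2) + Q ^ 3 * ε := by
    have h1 : D * (Q ^ 2 * ε) ≤ Q * (Q ^ 2 * ε) :=
      mul_le_mul_of_nonneg_right (hDs.trans hsQ) (by positivity)
    linarith
  have h3 : n * α * β * (ε + 2 * τ) ≤ s * (Q ^ 3 * (ε + 2 * τ)) := by
    calc n * α * β * (ε + 2 * τ) = s * (s * (α * β) * (ε + 2 * τ)) := by rw [← hs2]; ring
      _ ≤ s * (Q * Q ^ 2 * (ε + 2 * τ)) := by gcongr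
      _ = _ := by ring
  have h4 : s * (D * ((dR + dS + (α ^ 2 + β ^ 2) * ε) / 2)) ≤
      s * (D * ((U + H * U + (Q ^ 2 + Q ^ 2) * ε) / 2)) := by gcongr
  have h5 : s * (D * ((U + H * U + (Q ^ 2 + Q ^ 2) * ε) / 2)) ≤
      s * (D * (U * (1 + H) / 2) + Q ^ 3 * ε) := mul_le_mul_of_nonneg_left h2 (by linarith)
  have h6 : s * (Q ^ 3 * (2 * ε + 2 * τ)) ≤ s * U :=
    mul_le_mul_of_nonneg_left (herr.trans hU1) (by linarith)
  have h7 : s * (U * (c * ρ * W)) ≤ s * (U * (D * ((1 + H) / 2) + 1)) := by linarith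
  exact le_of_mul_le_mul_left (le_of_mul_le_mul_left h7 (by linarith)) (by linarith)

theorem supDirichletPoly_lower_bound {f : ℕ → ℂ} (hf : f ∈ UnimodularCompletelyMultiplicative)
    {N : ℕ} (hN : 1 ≤ N) {T Q : ℝ} (hT : 0 < T) {v : ℝ≥0} (hv : v ≠ 0) {P G : Finset ℕ}
    (hP : ∀ p ∈ P, p.Prime) (hG : ∀ g ∈ G, g.Prime) (hGN : ∀ g ∈ G, g ≤ N) (hGP : Disjoint G P)
    {r : ℕ → ℝ} (hr : ∀ p ∈ P, 0 < r p) (hr1 : ∀ p ∈ P, r p ≤ 1) {a b c H ρ : ℝ}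
    (ha : 0 < a) (hb : 0 < b) (hc0 : 0 ≤ c) (hQ : N * Real.exp a ≤ Q)
    (hc : ∀ x : ℝ, N * Real.exp (-b) ≤ x → x ≤ N →
      c * Real.sqrt x ≤ ∑ g ∈ G with ((g : ℕ) : ℝ) ≤ x, 1 / Real.sqrt g)
    (hH : ∑ g ∈ G, 1 / (g : ℝ) ≤ H)
    (hρ : ρ ≤ 1 - (∑ p ∈ P, Real.log p * (r p ^ 2 + r p / Real.sqrt p)) / a -
      (∑ p ∈ P, Real.log p * (r p / Real.sqrt p)) / b)
    (herr : Q ^ 3 * (2 * Real.exp (-(v / (2 * Q ^ 2))) + 2 * Real.exp (-(T ^ 2 / (2 * v)))) ≤ 1) :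
    c * ρ * ∏ p ∈ P, (1 + r p / Real.sqrt p / (1 + r p ^ 2)) ≤
      supDirichletPoly f N T * ((1 + H) / 2) + 1 := by
  set BB : Finset (Finset ℕ) := {B ∈ P.powerset | ∑ p ∈ B, Real.log (p : ℕ) ≤ a} with hBB
  set D := supDirichletPoly f N T with hD
  set U := ∏ p ∈ P, (1 + r p ^ 2) with hU
  have hN' : (1 : ℝ) ≤ N := by exact_mod_cast hN
  have hexp : 1 ≤ Real.exp a := Real.one_le_exp ha.le
  have hQN : (N : ℝ) ≤ Q := by nlinarith
  have hBP : ∀ B ∈ BB, B ⊆ P := fun B hB =>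
    Finset.mem_powerset.1 (Finset.mem_filter.1 hB).1
  have hrpos : ∀ B ∈ BB, 0 < ∏ p ∈ B, r p := fun B hB =>
    Finset.prod_pos fun p hp => hr p (hBP B hB hp)
  have hrle : ∀ B ∈ BB, ∏ p ∈ B, r p ≤ 1 := fun B hB =>
    Finset.prod_le_one (fun p hp => (hr p (hBP B hB hp)).le) fun p hp => hr1 p (hBP B hB hp)
  have hnB : ∀ B ∈ BB, 1 ≤ ∏ p ∈ B, p ∧ ((∏ p ∈ B, p : ℕ) : ℝ) ≤ Real.exp a := by
    intro B hB
    have hBp : ∀ p ∈ B, p.Prime := fun p hp => hP p (hBP B hB hp)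
    refine ⟨Finset.prod_pos fun p hp => (hBp p hp).pos, ?_⟩
    rw [prod_cast_eq_exp_sum_log hBp]
    exact Real.exp_le_exp.2 (Finset.mem_filter.1 hB).2
  -- The sets in `BB` correspond to distinct integers in `[1, e^a]`.
  have hcard : (BB.card : ℝ) ≤ Real.exp a := by
    have h1 : BB.card ≤ (Finset.Icc 1 ⌊Real.exp a⌋₊).card := by
      refine Finset.card_le_card_of_injOn (fun B => ∏ p ∈ B, p) ?_
        ((injOn_prod_primes hP).mono (by rw [hBB]; exact_mod_cast Finset.filter_subset _ _))
      intro B hB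
      rw [Finset.mem_coe, Finset.mem_Icc]
      exact ⟨(hnB B hB).1, Nat.le_floor (hnB B hB).2⟩
    rw [Nat.card_Icc, Nat.add_sub_cancel] at h1
    exact (Nat.cast_le.2 h1).trans (Nat.floor_le (Real.exp_pos a).le)
  have hGcard : (G.card : ℝ) ≤ N := by
    have h1 : G.card ≤ (Finset.Icc 1 N).card :=
      Finset.card_le_card fun g hg => Finset.mem_Icc.2 ⟨(hG g hg).one_le, hGN g hg⟩
    rw [Nat.card_Icc, Nat.add_sub_cancel] at h1
    exact_mod_cast h1
  have hres := resonance_inequality hf hN hT hv BB (G ×ˢ BB) (Q := Q)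
    (α := fun B => ∏ p ∈ B, r p) (ν := fun B => ∏ p ∈ B, p)
    (β := fun x => 1 / Real.sqrt x.1 * ∏ p ∈ x.2, r p) (μ := fun x => x.1 * ∏ p ∈ x.2, p)
    (fun B hB => (hrpos B hB).le)
    (fun x hx => mul_nonneg (by positivity) (hrpos _ (Finset.mem_product.1 hx).2).le)
    (fun B hB => ⟨(hnB B hB).1, le_trans (by have := (hnB B hB).2; gcongr) hQ⟩)
    (fun x hx => by
      rw [Finset.mem_product] at hx
      refine ⟨Nat.mul_pos (hG _ hx.1).pos (hnB _ hx.2).1, le_trans ?_ hQ⟩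
      rw [Nat.cast_mul]
      have h1 := (hnB _ hx.2).2
      have h2 : (x.1 : ℝ) ≤ N := by exact_mod_cast hGN _ hx.1
      gcongr)
  have hdiag := le_diagonalSum_resonators (N := N) hP hG hr (a := a) (b := b) hc
  rw [← hBB] at hdiag
  have hdR : diagonalSum BB (fun B => ∏ p ∈ B, r p) (fun B => ∏ p ∈ B, p) BB
      (fun B => ∏ p ∈ B, r p) (fun B => ∏ p ∈ B, p) ≤ U := by
    rw [diagonalSum_self BB _ ((injOn_prod_primes hP).mono (by
      rw [hBB]; exact_mod_cast Finset.filter_subset _ _)), hU, Finset.prod_one_add]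
    simp_rw [← Finset.prod_pow]
    exact Finset.sum_le_sum_of_subset_of_nonneg (Finset.filter_subset _ _)
      fun B _ _ => Finset.prod_nonneg fun p _ => sq_nonneg _
  have hdS : diagonalSum (G ×ˢ BB) (fun x => 1 / Real.sqrt x.1 * ∏ p ∈ x.2, r p)
      (fun x => x.1 * ∏ p ∈ x.2, p) (G ×ˢ BB) (fun x => 1 / Real.sqrt x.1 * ∏ p ∈ x.2, r p)
      (fun x => x.1 * ∏ p ∈ x.2, p) ≤ H * U := by
    rw [diagonalSum_self (G ×ˢ BB) _ ((injOn_mul_prod_primes hP hG hGP).mono (by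
      exact Finset.coe_subset.2 (Finset.product_subset_product_right
        (show BB ⊆ P.powerset from Finset.filter_subset _ _))))]
    have e : ∑ x ∈ G ×ˢ BB, (1 / Real.sqrt x.1 * ∏ p ∈ x.2, r p) ^ 2 =
        (∑ g ∈ G, 1 / (g : ℝ)) * ∑ B ∈ BB, ∏ p ∈ B, r p ^ 2 := by
      rw [Finset.sum_product, Finset.sum_mul_sum]
      refine Finset.sum_congr rfl fun g _ => Finset.sum_congr rfl fun B _ => ?_
      simp only
      rw [mul_pow, div_pow, one_pow, Real.sq_sqrt (Nat.cast_nonneg g), Finset.prod_pow]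
    have hle : ∑ B ∈ BB, ∏ p ∈ B, r p ^ 2 ≤ U := by
      rw [hU, Finset.prod_one_add]
      exact Finset.sum_le_sum_of_subset_of_nonneg (Finset.filter_subset _ _)
        fun B _ _ => Finset.prod_nonneg fun p _ => sq_nonneg _
    rw [e]
    have h0 : 0 ≤ ∑ B ∈ BB, ∏ p ∈ B, r p ^ 2 :=
      Finset.sum_nonneg fun B _ => Finset.prod_nonneg fun p _ => sq_nonneg _
    have h1 : 0 ≤ ∑ g ∈ G, 1 / (g : ℝ) := Finset.sum_nonneg fun g _ => by positivity
    exact mul_le_mul hH hle h0 (h1.trans hH)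
  have hα : ∑ B ∈ BB, ∏ p ∈ B, r p ≤ Q := by
    refine (Finset.sum_le_card_nsmul BB _ 1 hrle).trans ?_
    rw [nsmul_eq_mul, mul_one]
    nlinarith
  have hα0 : 0 ≤ ∑ B ∈ BB, ∏ p ∈ B, r p := Finset.sum_nonneg fun B hB => (hrpos B hB).le
  have hβ : ∑ x ∈ G ×ˢ BB, 1 / Real.sqrt x.1 * ∏ p ∈ x.2, r p ≤ Q := by
    refine (Finset.sum_le_card_nsmul (G ×ˢ BB) _ 1 fun x hx => ?_).trans ?_
    · rw [Finset.mem_product] at hx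
      refine mul_le_one₀ ?_ (hrpos _ hx.2).le (hrle _ hx.2)
      have : (1 : ℝ) ≤ Real.sqrt x.1 := Real.one_le_sqrt.2 (by exact_mod_cast (hG _ hx.1).one_le)
      exact div_le_one_of_le₀ this (by linarith)
    · rw [nsmul_eq_mul, mul_one, Finset.card_product, Nat.cast_mul]
      refine le_trans ?_ hQ
      gcongr
  have hβ0 : 0 ≤ ∑ x ∈ G ×ˢ BB, 1 / Real.sqrt x.1 * ∏ p ∈ x.2, r p :=
    Finset.sum_nonneg fun x hx => mul_nonneg (by positivity)
      (hrpos _ (Finset.mem_product.1 hx).2).le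
  set α := ∑ B ∈ BB, ∏ p ∈ B, r p
  set β := ∑ x ∈ G ×ˢ BB, 1 / Real.sqrt x.1 * ∏ p ∈ x.2, r p
  set ε := Real.exp (-(v / (2 * Q ^ 2)))
  set τ := Real.exp (-(T ^ 2 / (2 * v)))
  have hε0 : 0 < ε := Real.exp_pos _
  have hτ0 : 0 < τ := Real.exp_pos _
  have hmarkov := le_sum_powerset_filter_of_markov P (r := r)
    (z := fun p => 1 / (r p * Real.sqrt p)) (w := fun p : ℕ => Real.log p) ha hb
    (fun p hp => by have := hr p hp; positivity) (fun p _ => Real.log_natCast_nonneg p)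
  have hz : ∀ p ∈ P, r p ^ 2 * (1 / (r p * Real.sqrt p)) = r p / Real.sqrt p := by
    intro p hp
    have h1 := hr p hp
    have h2 : 0 < Real.sqrt p := Real.sqrt_pos.2 (by exact_mod_cast (hP p hp).pos)
    field_simp
  have hz1 : ∀ p ∈ P, r p ^ 2 * (1 + 1 / (r p * Real.sqrt p)) = r p ^ 2 + r p / Real.sqrt p := by
    intro p hp
    rw [mul_add, hz p hp, mul_one]
  have hWU : ∏ p ∈ P, (1 + r p ^ 2 * (1 + 1 / (r p * Real.sqrt p))) =
      U * ∏ p ∈ P, (1 + r p / Real.sqrt p / (1 + r p ^ 2)) := by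
    rw [hU, ← Finset.prod_mul_distrib]
    refine Finset.prod_congr rfl fun p hp => ?_
    rw [hz1 p hp]
    field_simp
    ring
  have hE1 : ∑ p ∈ P, Real.log p * (r p ^ 2 * (1 + 1 / (r p * Real.sqrt p))) =
      ∑ p ∈ P, Real.log p * (r p ^ 2 + r p / Real.sqrt p) :=
    Finset.sum_congr rfl fun p hp => by rw [hz1 p hp]
  have hE2 : ∑ p ∈ P, Real.log p * (r p ^ 2 * (1 / (r p * Real.sqrt p))) =
      ∑ p ∈ P, Real.log p * (r p / Real.sqrt p) :=
    Finset.sum_congr rfl fun p hp => by rw [hz p hp]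
  rw [hE1, hE2, hWU] at hmarkov
  have hU1 : 1 ≤ U := Finset.one_le_prod fun p _ => by nlinarith [sq_nonneg (r p)]
  have hW1 : 0 ≤ ∏ p ∈ P, (1 + r p / Real.sqrt p / (1 + r p ^ 2)) :=
    Finset.prod_nonneg fun p hp => by have := hr p hp; positivity
  set W := ∏ p ∈ P, (1 + r p / Real.sqrt p / (1 + r p ^ 2))
  have hs1 : 1 ≤ Real.sqrt N := Real.one_le_sqrt.2 hN'
  have hs2 : Real.sqrt N * Real.sqrt N = N := Real.mul_self_sqrt (by linarith)
  have hDs : D ≤ Real.sqrt N := by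
    refine csSup_le ⟨_, 0, by simpa using hT.le, rfl⟩ ?_
    rintro _ ⟨t, _, rfl⟩
    exact norm_dirichletPoly_le hf hN t
  have hD0 : 0 ≤ D :=
    (norm_nonneg _).trans (norm_dirichletPoly_le_sup hf hN (t := 0) (by simpa using hT.le))
  exact lower_bound_of_resonance_inequality hs1 hs2 hD0 hDs hU1 hQN hα0 hα hβ0 hβ hε0.le hτ0.le
    hdR hdS ((mul_le_mul_of_nonneg_left ((mul_le_mul_of_nonneg_left hρ
      (by positivity)).trans hmarkov) (by positivity)).trans (hdiag.trans hres)) herr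

/-! ### Asymptotic inequalities for the parameters. -/

/-- A lossy form of Chebyshev's bound: the term `√z` pays for discarding the primes up to `X^K`, and
the lost logarithm is harmless. -/
theorem eventually_div_log_sq_add_sqrt_le_primeCounting :
    ∀ᶠ z : ℝ in atTop, z / Real.log z ^ 2 + Real.sqrt z ≤ Nat.primeCounting ⌊z⌋₊ := by
  have h1 := (isLittleO_log_rpow_atTop (r := 1 / 2) (by norm_num)).bound
    (show (0 : ℝ) < 1 / 10 by norm_num)
  filter_upwards [h1, Real.tendsto_log_atTop.eventually_ge_atTop 10, eventually_ge_atTop 100]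
    with z h1 h2 h3
  refine le_trans ?_ (Chebyshev.pi_ge' (by linarith))
  rw [← Real.sqrt_eq_rpow, Real.norm_of_nonneg (by linarith),
    Real.norm_of_nonneg (Real.sqrt_nonneg _)] at h1
  have hs : Real.sqrt z * Real.sqrt z = z := Real.mul_self_sqrt (by linarith)
  have hs0 := Real.sqrt_nonneg z
  have hs10 : 10 ≤ Real.sqrt z := Real.le_sqrt_of_sq_le (by linarith)
  have hl2 : Real.log (z + 2) ≤ Real.log z + Real.log 2 := by
    rw [← Real.log_mul (by linarith) (by norm_num)]
    exact Real.log_le_log (by linarith) (by linarith)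
  have := Real.log_two_gt_d9
  have := Real.log_two_lt_d9
  rw [le_div_iff₀ (by linarith), add_mul]
  have e : z / Real.log z ^ 2 * Real.log z ≤ z / 10 := by
    have : z / Real.log z ^ 2 * Real.log z = z / Real.log z := by field_simp
    rw [this]
    gcongr
  nlinarith

theorem le_sum_one_div_sqrt_primesBetween {z0 lN K0 x : ℝ} {N : ℕ}
    (hz0 : ∀ z ≥ z0, z / Real.log z ^ 2 + Real.sqrt z ≤ Nat.primeCounting ⌊z⌋₊)
    (hlN : lN = Real.log N) (hxz : z0 ≤ x) (hx1 : 1 < x) (hxN : x ≤ N) (hK0 : 0 ≤ K0)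
    (hKx : K0 ≤ Real.sqrt x) :
    1 / lN ^ 2 * Real.sqrt x ≤
      ∑ g ∈ primesBetween K0 N with ((g : ℕ) : ℝ) ≤ x, 1 / Real.sqrt g := by
  have hx0 : 0 < x := by linarith
  have hlx : 0 < Real.log x := Real.log_pos hx1
  have hlxN : Real.log x ≤ lN := hlN ▸ Real.log_le_log hx0 hxN
  have hsub : (Nat.primesLE ⌊x⌋₊) \ (Finset.Icc 1 ⌊K0⌋₊) ⊆
      {g ∈ primesBetween K0 N | ((g : ℕ) : ℝ) ≤ x} := by
    intro p hp
    rw [Finset.mem_sdiff, Nat.mem_primesLE, Finset.mem_Icc] at hp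
    obtain ⟨⟨hpx, hpp⟩, hpK⟩ := hp
    rw [Nat.le_floor_iff hx0.le] at hpx
    have : K0 < p := by
      rw [← Nat.floor_lt hK0]
      have := hpp.one_le
      omega
    rw [Finset.mem_filter, mem_primesBetween hK0 (Nat.cast_nonneg _)]
    exact ⟨⟨⟨this, hpx.trans hxN⟩, hpp⟩, hpx⟩
  have hcard : x / lN ^ 2 ≤ ({g ∈ primesBetween K0 N | ((g : ℕ) : ℝ) ≤ x}.card : ℝ) := by
    have h1 := (Finset.le_card_sdiff (Finset.Icc 1 ⌊K0⌋₊) (Nat.primesLE ⌊x⌋₊)).trans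
      (Finset.card_le_card hsub)
    rw [Nat.primesLE_card_eq_primeCounting, Nat.card_Icc, Nat.add_sub_cancel,
      Nat.sub_le_iff_le_add] at h1
    have h2 : (Nat.primeCounting ⌊x⌋₊ : ℝ) ≤
        ({g ∈ primesBetween K0 N | ((g : ℕ) : ℝ) ≤ x}.card : ℝ) + (⌊K0⌋₊ : ℝ) := by
      exact_mod_cast h1
    have h3 := hz0 x hxz
    have h4 := Nat.floor_le hK0
    have h5 : x / lN ^ 2 ≤ x / Real.log x ^ 2 := by gcongr
    linarith
  have hs : 0 < Real.sqrt x := Real.sqrt_pos.2 hx0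
  calc 1 / lN ^ 2 * Real.sqrt x = x / lN ^ 2 * (1 / Real.sqrt x) := by
        have hsx : x = Real.sqrt x * Real.sqrt x := (Real.mul_self_sqrt hx0.le).symm
        have : 0 < lN := by linarith
        field_simp
        rw [Real.sq_sqrt hx0.le]
    _ ≤ ({g ∈ primesBetween K0 N | ((g : ℕ) : ℝ) ≤ x}.card : ℝ) * (1 / Real.sqrt x) := by gcongr
    _ ≤ _ := by
        rw [← nsmul_eq_mul]
        refine Finset.card_nsmul_le_sum _ _ _ fun g hg => ?_
        rw [Finset.mem_filter, mem_primesBetween hK0 (Nat.cast_nonneg _)] at hg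
        have : (0 : ℝ) < g := by exact_mod_cast hg.1.2.pos
        have := hg.2
        gcongr

theorem sum_one_div_primesBetween_le {K0 : ℝ} (hK0 : 0 ≤ K0) (N : ℕ) :
    ∑ g ∈ primesBetween K0 N, 1 / (g : ℝ) ≤ 1 + Real.log N := by
  refine le_trans ?_ (harmonic_le_one_add_log N)
  rw [harmonic_eq_sum_Icc]
  push_cast
  simp_rw [one_div]
  refine Finset.sum_le_sum_of_subset_of_nonneg ?_ fun i _ _ => by positivity
  intro p hp
  rw [mem_primesBetween hK0 (Nat.cast_nonneg _)] at hp
  exact Finset.mem_Icc.2 ⟨hp.2.one_le, by exact_mod_cast hp.1.2⟩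

theorem eventually_sqrt_mul_log_le_rpow {c w : ℝ} (hc : 0 < c) (hw : 1 / 2 < w) :
    ∀ᶠ X : ℝ in atTop, Real.sqrt (2 * X * Real.log X) ≤ c * X ^ w := by
  have h := (isLittleO_log_rpow_atTop (r := 2 * w - 1) (by linarith)).bound
    (show 0 < c ^ 2 / 2 by positivity)
  filter_upwards [h, eventually_gt_atTop 1] with X h hX
  have hX0 : 0 < X := by linarith
  rw [Real.norm_of_nonneg (Real.log_pos hX).le, Real.norm_of_nonneg (by positivity)] at h
  refine Real.sqrt_le_iff.2 ⟨by positivity, ?_⟩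
  have e : (X ^ w) ^ 2 = X * X ^ (2 * w - 1) := by
    rw [← Real.rpow_natCast (X ^ w), ← Real.rpow_mul hX0.le]
    conv_rhs => enter [1]; rw [← Real.rpow_one X]
    rw [← Real.rpow_add hX0]
    congr 1
    push_cast
    ring
  rw [mul_pow, e]
  calc 2 * X * Real.log X ≤ 2 * X * (c ^ 2 / 2 * X ^ (2 * w - 1)) := by gcongr
    _ = _ := by ring

theorem eventually_exp_mul_le_one {d : ℝ} (hd : 0 < d) :
    ∀ᶠ X : ℝ in atTop, Real.exp (3 * X) * (4 * Real.exp (-(Real.exp (d * X) / 2))) ≤ 1 := by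
  have h := (isLittleO_pow_exp_pos_mul_atTop 1 hd).bound (show (0 : ℝ) < 1 / 20 by norm_num)
  filter_upwards [h, eventually_ge_atTop 1] with X h hX
  rw [Real.norm_of_nonneg (by positivity), Real.norm_of_nonneg (by positivity), pow_one] at h
  have h4 : (4 : ℝ) ≤ Real.exp 3 := by
    have := Real.add_one_le_exp (3 : ℝ)
    linarith
  calc Real.exp (3 * X) * (4 * Real.exp (-(Real.exp (d * X) / 2)))
      ≤ Real.exp (3 * X) * (Real.exp 3 * Real.exp (-(Real.exp (d * X) / 2))) := by gcongr
    _ = Real.exp (3 * X + (3 + -(Real.exp (d * X) / 2))) := by rw [← Real.exp_add, ← Real.exp_add]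
    _ ≤ 1 := by
        rw [Real.exp_le_one_iff]
        linarith

/-- Since `log X ≤ √X` eventually, `√(X/log X) ≥ X^{1/4}`, and `exp(θ X^{1/4})` beats the twelfth
power of `X^{1/4}`. -/
theorem eventually_pow_le_exp_sqrt {θ ρ : ℝ} (hθ : 0 < θ) (hρ : 0 < ρ) :
    ∀ᶠ X : ℝ in atTop, X ^ 2 * (X + 2) ≤ ρ * Real.exp (θ * Real.sqrt (X / Real.log X)) := by
  have h1 := (isLittleO_log_rpow_atTop (r := 1 / 2) (by norm_num)).bound
    (show (0 : ℝ) < 1 by norm_num)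
  have h2 := ((isLittleO_pow_exp_pos_mul_atTop 12 hθ).bound (show 0 < ρ / 2 by positivity))
  have h3 := (tendsto_rpow_atTop (show (0 : ℝ) < 1 / 4 by norm_num)).eventually h2
  filter_upwards [h1, h3, eventually_ge_atTop 2] with X h1 h3 hX
  have hX0 : 0 < X := by linarith
  have hl : 0 < Real.log X := Real.log_pos (by linarith)
  rw [Real.norm_of_nonneg hl.le, Real.norm_of_nonneg (by positivity), one_mul] at h1
  rw [Real.norm_of_nonneg (by positivity), Real.norm_of_nonneg (by positivity)] at h3
  have e1 : (X ^ (1 / 4 : ℝ)) ^ 12 = X ^ 3 := by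
    rw [← Real.rpow_natCast (X ^ (1 / 4 : ℝ)), ← Real.rpow_mul hX0.le]
    norm_num
  have e2 : X ^ (1 / 4 : ℝ) ≤ Real.sqrt (X / Real.log X) := by
    refine Real.le_sqrt_of_sq_le ?_
    rw [← Real.rpow_natCast (X ^ (1 / 4 : ℝ)), ← Real.rpow_mul hX0.le, le_div_iff₀ hl]
    norm_num
    calc X ^ (1 / 2 : ℝ) * Real.log X ≤ X ^ (1 / 2 : ℝ) * X ^ (1 / 2 : ℝ) := by gcongr
      _ = X := by rw [← Real.rpow_add hX0]; norm_num
  rw [e1] at h3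
  have h4 : Real.exp (θ * X ^ (1 / 4 : ℝ)) ≤ Real.exp (θ * Real.sqrt (X / Real.log X)) := by gcongr
  have h5 : X ^ 2 * (X + 2) ≤ 2 * X ^ 3 := by nlinarith [sq_nonneg X]
  nlinarith

theorem exp_mul_le_one_add_div {θ r y : ℝ} (hθ : θ ≤ 1 / 2) (hr : r ≤ θ / 2) (hy : 0 < y)
    (hyr : y ≤ r) : Real.exp ((1 - θ) * y) ≤ 1 + y / (1 + r ^ 2) := by
  have hpos : 0 < 1 + y / (1 + r ^ 2) := by positivity
  rw [← Real.le_log_iff_exp_le hpos]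
  refine le_trans ?_ (Real.one_sub_inv_le_log_of_pos hpos)
  have e : 1 - (1 + y / (1 + r ^ 2))⁻¹ = y / (1 + r ^ 2 + y) := by
    field_simp
    ring
  rw [e, le_div_iff₀ (by positivity)]
  have h6 : 1 + r ^ 2 + y ≤ 1 + θ := by nlinarith
  calc (1 - θ) * y * (1 + r ^ 2 + y) ≤ (1 - θ) * y * (1 + θ) :=
        mul_le_mul_of_nonneg_left h6 (mul_nonneg (by linarith) hy.le)
    _ ≤ y := by nlinarith [mul_nonneg hy.le (sq_nonneg θ)]

/-! ### Choice of the resonator. -/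

/-- Maximising `∑ r(p)/√p` under `∑ r(p)² log p = κX`, with `κ = 1 - 3δ/4`, gives `r(p) = L/(√p log
p)` by Cauchy–Schwarz. The maximum is `√(κX ∑ 1/(p log p))`, about `√(κX/log X)`, and `κ > 1 - δ`
leaves the gain `θ`. -/
theorem exists_resonator {δ : ℝ} (hδ : 0 < δ) (hδ1 : δ < 1) :
    ∃ θ > 0, ∃ K ≥ 1, ∀ᶠ X : ℝ in atTop, ∃ r : ℕ → ℝ,
      (∀ p ∈ primesBetween X (X ^ K), 0 < r p) ∧ (∀ p ∈ primesBetween X (X ^ K), r p ≤ 1) ∧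
      ∑ p ∈ primesBetween X (X ^ K), Real.log p * (r p ^ 2 + r p / Real.sqrt p) ≤
        (1 - 3 * δ / 4) * X + K * Real.sqrt (2 * X * Real.log X) ∧
      ∑ p ∈ primesBetween X (X ^ K), Real.log p * (r p / Real.sqrt p) ≤
        K * Real.sqrt (2 * X * Real.log X) ∧
      Real.exp ((Real.sqrt (1 - δ) + θ) * Real.sqrt (X / Real.log X)) ≤
        ∏ p ∈ primesBetween X (X ^ K), (1 + r p / Real.sqrt p / (1 + r p ^ 2)) := by
  obtain ⟨θ, hθ0, hθ1, hθ⟩ : ∃ θ : ℝ, 0 < θ ∧ θ ≤ 1 / 2 ∧ Real.sqrt (1 - δ) + θ ≤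
      (1 - θ) * Real.sqrt ((1 - 3 * δ / 4) * (1 - θ)) := by
    have h0 : Real.sqrt (1 - δ) + 0 < (1 - 0) * Real.sqrt ((1 - 3 * δ / 4) * (1 - 0)) := by
      simp only [add_zero, sub_zero, one_mul, mul_one]
      exact Real.sqrt_lt_sqrt (by linarith) (by linarith)
    have hL : Continuous fun θ : ℝ => Real.sqrt (1 - δ) + θ := by fun_prop
    have hR : Continuous fun θ : ℝ => (1 - θ) * Real.sqrt ((1 - 3 * δ / 4) * (1 - θ)) := by fun_prop
    have hev := (hL.continuousAt.eventually_lt hR.continuousAt h0).filter_mono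
      (nhdsWithin_le_nhds (s := Set.Ioi 0))
    have hev2 : ∀ᶠ θ : ℝ in nhdsWithin 0 (Set.Ioi 0), θ ∈ Set.Ioo (0 : ℝ) (1 / 2) :=
      Ioo_mem_nhdsGT (by norm_num)
    obtain ⟨θ, h1, h2⟩ := (hev.and hev2).exists
    exact ⟨θ, h2.1, h2.2.le, h1.le⟩
  obtain ⟨K, hK, hX⟩ := exists_le_sum_inv_mul_log_primesBetween hθ0
  refine ⟨θ, hθ0, K, hK, ?_⟩
  -- `r(p)² ≤ 2X log X/(X log² X) = 2/log X`, so `log X ≥ 8/θ²` gives `r(p) ≤ θ/2`.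
  filter_upwards [hX, eventually_gt_atTop 1, Real.tendsto_log_atTop.eventually_ge_atTop (8 / θ ^ 2)]
    with X ⟨hSig, hrec⟩ hX1 hlX
  set P := primesBetween X (X ^ K) with hP
  set Sig := ∑ p ∈ P, 1 / (p * Real.log p) with hSigdef
  set κ := 1 - 3 * δ / 4 with hκ
  have hκ0 : 0 < κ := by linarith
  have hX0 : 0 < X := by linarith
  have hl : 0 < Real.log X := Real.log_pos hX1
  have hSig0 : 0 < Sig := lt_of_lt_of_le (div_pos (by linarith) hl) hSig
  set L := Real.sqrt (κ * X / Sig) with hL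
  have hL0 : 0 < L := Real.sqrt_pos.2 (by positivity)
  have hLsq : L ^ 2 = κ * X / Sig := Real.sq_sqrt (by positivity)
  have hLsq2 : L ^ 2 ≤ 2 * X * Real.log X := by
    rw [hLsq, div_le_iff₀ hSig0]
    rw [div_le_iff₀ hl] at hSig
    have : X * (1 / 2) ≤ X * (Sig * Real.log X) := by gcongr; linarith
    nlinarith
  have hLle : L ≤ Real.sqrt (2 * X * Real.log X) := Real.le_sqrt_of_sq_le hLsq2
  have hmem : ∀ p ∈ P, X < p ∧ 0 < Real.sqrt p ∧ Real.log X ≤ Real.log p ∧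
      Real.sqrt p ^ 2 = p ∧ 1 ≤ Real.sqrt p := by
    intro p hp
    rw [hP, mem_primesBetween hX0.le (by positivity)] at hp
    have h1 := hp.1.1
    exact ⟨h1, Real.sqrt_pos.2 (by linarith), Real.log_le_log hX0 h1.le,
      Real.sq_sqrt (by linarith), Real.one_le_sqrt.2 (by linarith)⟩
  have hr2 : ∀ p ∈ P, L / (Real.sqrt p * Real.log p) ≤ θ / 2 := by
    intro p hp
    obtain ⟨h1, h2, h3, h4, -⟩ := hmem p hp
    have hlp : 0 < Real.log p := by linarith
    have hp0 : (0 : ℝ) < p := by linarith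
    refine abs_le_of_sq_le_sq' ?_ (by positivity) |>.2
    rw [div_pow, mul_pow, h4, div_le_iff₀ (by positivity)]
    rw [div_le_iff₀ (by positivity)] at hlX
    calc L ^ 2 ≤ 2 * X * Real.log X := hLsq2
      _ ≤ (θ / 2) ^ 2 * (X * Real.log X ^ 2) := by
          have : 0 < X * Real.log X := by positivity
          nlinarith
      _ ≤ _ := by gcongr
  have hE2 : ∑ p ∈ P, Real.log p * (L / (Real.sqrt p * Real.log p) / Real.sqrt p) ≤
      K * Real.sqrt (2 * X * Real.log X) := by
    have e : ∑ p ∈ P, Real.log p * (L / (Real.sqrt p * Real.log p) / Real.sqrt p) =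
        L * ∑ p ∈ P, 1 / (p : ℝ) := by
      rw [Finset.mul_sum]
      refine Finset.sum_congr rfl fun p hp => ?_
      obtain ⟨h1, h2, h3, h4, -⟩ := hmem p hp
      have hlp : 0 < Real.log p := by linarith
      have hp0 : (0 : ℝ) < p := by linarith
      rw [div_div, mul_right_comm, ← sq, h4]
      field_simp
    rw [e, mul_comm K]
    exact mul_le_mul hLle hrec (Finset.sum_nonneg fun p _ => by positivity) (by positivity)
  refine ⟨fun p => L / (Real.sqrt p * Real.log p), fun p hp => ?_, fun p hp => ?_, ?_, hE2, ?_⟩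
  · obtain ⟨h1, h2, h3, h4, -⟩ := hmem p hp
    have hlp : 0 < Real.log p := by linarith
    positivity
  · exact (hr2 p hp).trans (by linarith)
  · have e : ∑ p ∈ P, Real.log p * (L / (Real.sqrt p * Real.log p)) ^ 2 = κ * X := by
      have : κ * X = L ^ 2 * Sig := by rw [hLsq]; field_simp
      rw [this, hSigdef, Finset.mul_sum]
      refine Finset.sum_congr rfl fun p hp => ?_
      obtain ⟨h1, h2, h3, h4, -⟩ := hmem p hp
      have hlp : 0 < Real.log p := by linarith
      have hp0 : (0 : ℝ) < p := by linarith
      rw [div_pow, mul_pow, h4]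
      field_simp
    simp_rw [mul_add]
    rw [Finset.sum_add_distrib, e]
    linarith
  · have hprod : Real.exp (∑ p ∈ P, (1 - θ) * (L * (1 / (p * Real.log p)))) ≤
        ∏ p ∈ P, (1 + L / (Real.sqrt p * Real.log p) / Real.sqrt p /
          (1 + (L / (Real.sqrt p * Real.log p)) ^ 2)) := by
      rw [Real.exp_sum]
      refine Finset.prod_le_prod (fun p _ => (Real.exp_pos _).le) fun p hp => ?_
      obtain ⟨h1, h2, h3, h4, h5⟩ := hmem p hp
      have hlp : 0 < Real.log p := by linarith
      have hp0 : (0 : ℝ) < p := by linarith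
      have hv : L / (Real.sqrt p * Real.log p) / Real.sqrt p = L * (1 / (p * Real.log p)) := by
        rw [div_div, mul_right_comm, ← sq, h4]
        ring
      have hrθ := hr2 p hp
      have hr0 : 0 < L / (Real.sqrt p * Real.log p) := by positivity
      have hvr := div_le_self hr0.le h5
      rw [hv] at hvr ⊢
      have hv0 : 0 < L * (1 / (p * Real.log p)) := by positivity
      set r := L / (Real.sqrt p * Real.log p)
      set y := L * (1 / (p * Real.log p))
      exact exp_mul_le_one_add_div hθ1 hrθ hv0 hvr
    refine le_trans (Real.exp_le_exp.2 ?_) hprod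
    rw [← Finset.mul_sum, ← Finset.mul_sum]
    have hLS : Real.sqrt (κ * (1 - θ)) * Real.sqrt (X / Real.log X) ≤ L * Sig := by
      rw [← Real.sqrt_mul (mul_nonneg hκ0.le (by linarith))]
      refine Real.sqrt_le_iff.2 ⟨by positivity, ?_⟩
      rw [mul_pow, hLsq]
      have : κ * X / Sig * Sig ^ 2 = κ * X * Sig := by field_simp
      rw [this]
      calc κ * (1 - θ) * (X / Real.log X) = κ * X * ((1 - θ) / Real.log X) := by ring
        _ ≤ κ * X * Sig := by gcongr
    calc (Real.sqrt (1 - δ) + θ) * Real.sqrt (X / Real.log X)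
        ≤ (1 - θ) * Real.sqrt (κ * (1 - θ)) * Real.sqrt (X / Real.log X) := by gcongr
      _ = (1 - θ) * (Real.sqrt (κ * (1 - θ)) * Real.sqrt (X / Real.log X)) := by ring
      _ ≤ (1 - θ) * (L * Sig) := mul_le_mul_of_nonneg_left hLS (by linarith)

/-! ### Assembly of the parameters. -/

theorem exp_div_two_mul_exp (x y : ℝ) : Real.exp x / (2 * Real.exp y) = Real.exp (x - y) / 2 := by
  rw [Real.exp_sub, div_div, mul_comm]

/-- With `T = e^X` and `Q = T^{1-d}`, the variance is the geometric mean of `Q²` and `T²`, so both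
ratios `v/Q²` and `T²/v` equal `T^d`. -/
theorem gaussian_error_le_one {d X : ℝ} (hd : 0 ≤ d) (hX : 0 ≤ X)
    (h : Real.exp (3 * X) * (4 * Real.exp (-(Real.exp (d * X) / 2))) ≤ 1) :
    Real.exp ((1 - d) * X) ^ 3 *
      (2 * Real.exp (-(Real.exp (2 * (1 - d / 2) * X) / (2 * Real.exp ((1 - d) * X) ^ 2))) +
        2 * Real.exp (-(Real.exp X ^ 2 / (2 * Real.exp (2 * (1 - d / 2) * X))))) ≤ 1 := by
  rw [← Real.exp_nat_mul, ← Real.exp_nat_mul, ← Real.exp_nat_mul, exp_div_two_mul_exp,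
    exp_div_two_mul_exp]
  have e1 : 2 * (1 - d / 2) * X - (2 : ℕ) * ((1 - d) * X) = d * X := by push_cast; ring
  have e2 : (2 : ℕ) * X - 2 * (1 - d / 2) * X = d * X := by push_cast; ring
  have h3 : (3 : ℕ) * ((1 - d) * X) ≤ 3 * X := by
    have := mul_nonneg hd hX
    push_cast
    linarith
  rw [e1, e2, ← add_mul, show (2 : ℝ) + 2 = 4 by norm_num]
  exact le_trans (by gcongr) h

theorem le_of_mul_exp_le {l X ρ S F D : ℝ} (hl : 1 ≤ l) (hlX : l ≤ X) (hS : 1 ≤ S)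
    (hF : X ^ 2 * (X + 2) ≤ ρ * F) (h : 1 / l ^ 2 * ρ * (S * F) ≤ D * ((1 + (1 + l)) / 2) + 1) :
    S ≤ D := by
  have h2 : l + 2 ≤ 1 / l ^ 2 * ρ * F := by
    rw [mul_assoc, one_div_mul_eq_div, le_div_iff₀ (by positivity)]
    calc (l + 2) * l ^ 2 ≤ (X + 2) * X ^ 2 := by gcongr; linarith
      _ ≤ _ := by linarith
  have h3 : (l + 2) * S ≤ 1 / l ^ 2 * ρ * F * S := by gcongr
  have h4 : S * ((2 + l) / 2) + 1 ≤ (l + 2) * S := by nlinarith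
  have h5 : S * ((2 + l) / 2) ≤ D * ((2 + l) / 2) := by linarith
  exact le_of_mul_le_mul_right h5 (by linarith)

theorem eventually_exp_le_supDirichletPoly {δ γ : ℝ} (hδ : δ ∈ Set.Ioo (0 : ℝ) 1)
    (hγ : γ ∈ Set.Ioo (0 : ℝ) 1) :
    ∀ᶠ N : ℕ in atTop, ∀ C T : ℝ, 2 / δ ≤ C → C ≤ Real.log N ^ γ → T = (N : ℝ) ^ C →
      ∀ f ∈ UnimodularCompletelyMultiplicative,
        Real.exp (Real.sqrt ((1 - δ) * (Real.log T / Real.log (Real.log T))))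
          ≤ supDirichletPoly f N T := by
  obtain ⟨hδ0, hδ1⟩ := hδ
  obtain ⟨hγ0, hγ1⟩ := hγ
  obtain ⟨θ, hθ, K, hK, hres⟩ := exists_resonator hδ0 hδ1
  -- `X ≤ l^{1+γ}` for `l = log N`, hence `X^w ≤ l`. As `γ < 1` gives `w > 1/2`, the mean of `log
  -- A`, of order at most `√(X log X)`, is `o(l)`.
  set w := 1 / (1 + γ) with hw
  have hw2 : 1 / 2 < w := by
    rw [hw, div_lt_div_iff₀ (by norm_num) (by linarith)]
    linarith
  have hA : 0 < 1 - 5 * δ / 8 := by linarith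
  have hXev := (((hres.and (eventually_sqrt_mul_log_le_rpow
    (show 0 < δ / 32 * (1 - 5 * δ / 8) / K by positivity) (show (1 / 2 : ℝ) < 1 by norm_num))).and
    (eventually_sqrt_mul_log_le_rpow (show 0 < δ / 128 / K by positivity) hw2)).and
    (eventually_exp_mul_le_one (show 0 < δ / 8 by positivity))).and
    (eventually_pow_le_exp_sqrt hθ (show 0 < δ / 16 by positivity))
  obtain ⟨X0, hX0⟩ := eventually_atTop.1 hXev
  obtain ⟨z0, hz0⟩ := eventually_atTop.1 eventually_div_log_sq_add_sqrt_le_primeCounting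
  have tlog : Tendsto (fun N : ℕ => Real.log N) atTop atTop :=
    Real.tendsto_log_atTop.comp tendsto_natCast_atTop_atTop
  have hpow := tlog.eventually ((isLittleO_rpow_exp_pos_mul_atTop (2 * K)
    (show (0 : ℝ) < 1 / 4 by norm_num)).bound (show (0 : ℝ) < 1 by norm_num))
  have hz0ev := tlog.eventually (((Real.tendsto_exp_atTop.comp
    (tendsto_id.const_mul_atTop (show (0 : ℝ) < 3 / 4 by norm_num)))).eventually_ge_atTop z0)
  filter_upwards [hpow, hz0ev, tlog.eventually_ge_atTop X0, tlog.eventually_ge_atTop 1,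
    eventually_ge_atTop 1] with N hpow hz0N hNX0 hlN1 hN1 C T hC1 hC2 hT f hf
  set l := Real.log N with hl
  have hN0 : (0 : ℝ) < N := by exact_mod_cast hN1
  have hNexp : Real.exp l = N := Real.exp_log hN0
  have hlogT : Real.log T = C * l := by rw [hT, Real.log_rpow hN0]
  rw [hlogT]
  set X := C * l with hX
  have hC2' : 2 ≤ C := le_trans (by rw [le_div_iff₀ hδ0]; linarith) hC1
  have hlX : 2 * l ≤ X := by rw [hX]; gcongr
  have hlδ : l ≤ δ / 2 * X := by
    rw [div_le_iff₀ hδ0] at hC1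
    nlinarith
  have hXpos : 0 < X := by linarith
  have hXl : X ≤ l ^ (1 + γ) := by
    rw [add_comm, Real.rpow_add_one (by linarith), hX]
    exact mul_le_mul_of_nonneg_right hC2 (by linarith)
  have hXw : X ^ w ≤ l := by
    calc X ^ w ≤ (l ^ (1 + γ)) ^ w := by gcongr
      _ = l := by
        rw [← Real.rpow_mul (by linarith), hw, mul_one_div_cancel (by linarith), Real.rpow_one]
  have hXl2 : X ≤ l ^ (2 : ℝ) := hXl.trans (Real.rpow_le_rpow_of_exponent_le hlN1 (by linarith))
  have hXK : X ^ K ≤ Real.exp (1 / 4 * l) := by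
    rw [Real.norm_of_nonneg (Real.rpow_nonneg (by linarith) _), Real.norm_of_nonneg
      (Real.exp_pos _).le, one_mul, Real.rpow_mul (by linarith)] at hpow
    exact le_trans (by gcongr) hpow
  obtain ⟨⟨⟨⟨⟨r, hr0, hr1, hE1, hE2, hprod⟩, hs1⟩, hs2⟩, herr⟩, hfin⟩ := hX0 X (by linarith)
  rw [Real.rpow_one] at hs1
  set P := primesBetween X (X ^ K) with hP
  set G := primesBetween (X ^ K) N with hG
  have hXK0 : 0 ≤ X ^ K := by positivity
  have hTexp : T = Real.exp X := by
    rw [hT, Real.rpow_def_of_pos hN0, hX, mul_comm]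
  set v : ℝ≥0 := ⟨Real.exp (2 * (1 - δ / 8 / 2) * X), (Real.exp_pos _).le⟩ with hv
  have hvr : (v : ℝ) = Real.exp (2 * (1 - δ / 8 / 2) * X) := rfl
  have hv0 : v ≠ 0 := by
    intro h
    have : (v : ℝ) = 0 := by rw [h]; rfl
    exact (Real.exp_pos _).ne' (hvr ▸ this)
  -- `N ≤ T^{δ/2}` and `e^a = T^{1-5δ/8}` give `Q = T^{1-δ/8}`. The mean of `log B` is about `(1 -
  -- 3δ/4)X ≤ (1 - δ/8)a`; the secondary term and the truncation of `A` cost `δ/32` each, leaving `ρ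
  -- = δ/16`.
  have hmain := supDirichletPoly_lower_bound hf hN1 (T := T) (Q := Real.exp ((1 - δ / 8) * X))
    (hTexp ▸ Real.exp_pos _) hv0 (P := P) (G := G)
    (fun p hp => ((mem_primesBetween hXpos.le hXK0).1 hp).2)
    (fun p hp => ((mem_primesBetween hXK0 hN0.le).1 hp).2)
    (fun p hp => by exact_mod_cast ((mem_primesBetween hXK0 hN0.le).1 hp).1.2)
    (Finset.disjoint_left.2 fun p hp hp' => by
      have h1 := ((mem_primesBetween hXK0 hN0.le).1 hp).1.1
      have h2 := ((mem_primesBetween hXpos.le hXK0).1 hp').1.2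
      linarith)
    hr0 hr1 (a := (1 - 5 * δ / 8) * X) (b := 1 / 4 * l) (c := 1 / l ^ 2) (H := 1 + l)
    (ρ := δ / 16) (by positivity) (by positivity) (by positivity)
    (by
      rw [← hNexp, ← Real.exp_add]
      exact Real.exp_le_exp.2 (by linarith))
    (by
      intro x hx1 hx2
      rw [← hNexp, ← Real.exp_add, show l + -(1 / 4 * l) = 3 / 4 * l by ring] at hx1
      refine le_sum_one_div_sqrt_primesBetween hz0 hl (le_trans hz0N hx1)
        (lt_of_lt_of_le ?_ hx1) hx2 hXK0 ?_
      · exact Real.one_lt_exp_iff.2 (by linarith)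
      · refine hXK.trans (Real.le_sqrt_of_sq_le (le_trans ?_ hx1))
        rw [← Real.exp_nat_mul]
        exact Real.exp_le_exp.2 (by push_cast; linarith))
    (sum_one_div_primesBetween_le hXK0 N)
    (by
      have b1 : (∑ p ∈ P, Real.log p * (r p ^ 2 + r p / Real.sqrt p)) / ((1 - 5 * δ / 8) * X) ≤
          1 - δ / 8 + δ / 32 := by
        rw [div_le_iff₀ (by positivity)]
        have h1 : K * Real.sqrt (2 * X * Real.log X) ≤ δ / 32 * (1 - 5 * δ / 8) * X := by
          calc _ ≤ K * (δ / 32 * (1 - 5 * δ / 8) / K * X) := by gcongr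
            _ = _ := by field_simp
        have h2 : (1 - 3 * δ / 4) * X ≤ (1 - δ / 8) * (1 - 5 * δ / 8) * X := by
          gcongr
          nlinarith
        linarith
      have b2 : (∑ p ∈ P, Real.log p * (r p / Real.sqrt p)) / (1 / 4 * l) ≤ δ / 32 := by
        rw [div_le_iff₀ (by positivity)]
        have h1 : K * Real.sqrt (2 * X * Real.log X) ≤ δ / 128 * l := by
          calc _ ≤ K * (δ / 128 / K * X ^ w) := by gcongr
            _ = δ / 128 * X ^ w := by field_simp
            _ ≤ _ := by gcongr
        linarith
      linarith)
    (by rw [hvr, hTexp]; exact gaussian_error_le_one (by positivity) (by positivity) herr)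
  set D := supDirichletPoly f N T
  have hsq : Real.sqrt ((1 - δ) * (X / Real.log X)) =
      Real.sqrt (1 - δ) * Real.sqrt (X / Real.log X) := Real.sqrt_mul (by linarith) _
  rw [hsq]
  rw [add_mul, Real.exp_add] at hprod
  have hS : 1 ≤ Real.exp (Real.sqrt (1 - δ) * Real.sqrt (X / Real.log X)) :=
    Real.one_le_exp (by positivity)
  set S := Real.exp (Real.sqrt (1 - δ) * Real.sqrt (X / Real.log X))
  set F := Real.exp (θ * Real.sqrt (X / Real.log X))
  have h1 : 1 / l ^ 2 * (δ / 16) * (S * F) ≤ D * ((1 + (1 + l)) / 2) + 1 :=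
    (mul_le_mul_of_nonneg_left hprod (by positivity)).trans hmain
  exact le_of_mul_exp_le (X := X) hlN1 (by linarith) hS hfin h1

theorem theorem1 (δ γ : ℝ) (hδ : δ ∈ Set.Ioo (0 : ℝ) 1) (hγ : γ ∈ Set.Ioo (0 : ℝ) 1) :
    ∀ᶠ N : ℕ in atTop, ∀ C T : ℝ, 2 / δ ≤ C → C ≤ Real.log N ^ γ → T = (N : ℝ) ^ C →
      (∀ f ∈ UnimodularCompletelyMultiplicative,
        Real.exp (Real.sqrt ((1 - δ) * (Real.log T / Real.log (Real.log T))))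
          ≤ supDirichletPoly f N T) ∧
      (∀ (Ω : Type*) [MeasurableSpace Ω] (P : Measure Ω) [IsProbabilityMeasure P]
        (X : ℕ → Ω → ℂ), IsSteinhaus P X → ∀ ω : Ω,
        Real.exp (Real.sqrt ((1 - δ) * (Real.log T / Real.log (Real.log T))))
          ≤ supDirichletPoly (fun n => X n ω) N T) := by
  filter_upwards [eventually_exp_le_supDirichletPoly hδ hγ] with N hN C T hC1 hC2 hT
  exact ⟨hN C T hC1 hC2 hT, fun Ω _ P _ X hX ω => hN C T hC1 hC2 hT _ (hX.realization ω)⟩
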